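/- **Proposition 5.1 (inclusion).** Let $dA=\pi^{-1}\,dx\,dy$ be the normalized area measure on the unit disk $\mathbb D$, let $L^2_a(\mathbb D)$ be the Bergman space, i.e. the closed subspace of analytic functions in $L^2(\mathbb D,dA)$, let $P$ be the orthogonal projection of $L^2(\mathbb D,dA)$ onto it, and for $\varphi\in L^\infty(\mathbb D,dA)$ let $T_\varphi f=P(\varphi f)$, $f\in L^2_a(\mathbb D)$, be the Toeplitz operator with symbol $\varphi$. Let $m\ge 1$ be an integer, let $\alpha,\beta\in\mathbb C$, and let $$\varphi(z)=\bar z^{\,m}+\alpha z^m+\beta .$$ Then $\overline{\varphi(\mathbb D)}\subset\sigma(T_\varphi)$. Moreover, if $|\alpha|\neq 1$, then $\varphi(\mathbb D)$ is an elliptical region: there is $\zeta\in\mathbb C$ with $|\zeta|=1$ and $\alpha=|\alpha|\zeta^2$ such that $$\varphi(\mathbb D)=\Big\{\beta+\zeta(x+iy):\ x,y\in\mathbb R,\ \frac{x^2}{(|\alpha|+1)^2}+\frac{y^2}{(|\alpha|-1)^2}<1\Big\};$$ and for every $w\in\varphi(\mathbb D)$ one has $w\notin\varphi(\mathbb T)$,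 where $\mathbb T=\partial\mathbb D$; the winding number about $w$ of the curve $\theta\mapsto\varphi(e^{i\theta})$, $0\le\theta\le 2\pi$, is nonzero; and $T_\varphi-w$ is a Fredholm operator whose index $\dim\ker(T_\varphi-w)-\dim\operatorname{coker}(T_\varphi-w)$ equals minus that winding number, hence is nonzero. -/

import Mathlib

open MeasureTheory Metric Filter Topology
open scoped ENNReal ComplexConjugate

/-- The normalized Lebesgue area measure `dA` on the open unit disk, `dA = π⁻¹ dx dy`,
as a measure on `ℂ` carried by the disk. -/
noncomputable def diskMeasure : Measure ℂ :=
  (ENNReal.ofReal Real.pi)⁻¹ • (volume : Measure ℂ).restrict (ball 0 1)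

/-- The Bergman space `L²ₐ(𝔻)`: the elements of `L²(𝔻, dA)` that are represented by a function
analytic on the disk. -/
noncomputable def bergmanSpace : Submodule ℂ (Lp ℂ 2 diskMeasure) where
  carrier := {f | ∃ g : ℂ → ℂ, DifferentiableOn ℂ g (ball 0 1) ∧ f =ᵐ[diskMeasure] g}
  add_mem' := by
    rintro f₁ f₂ ⟨g₁, h₁, e₁⟩ ⟨g₂, h₂, e₂⟩
    refine ⟨g₁ + g₂, h₁.add h₂, ?_⟩
    filter_upwards [Lp.coeFn_add f₁ f₂, e₁, e₂] with z h a b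
    rw [h, Pi.add_apply, Pi.add_apply, a, b]
  zero_mem' := ⟨0, differentiableOn_const 0, Lp.coeFn_zero ℂ 2 diskMeasure⟩
  smul_mem' := by
    rintro c f ⟨g, h, e⟩
    refine ⟨c • g, h.const_smul c, ?_⟩
    filter_upwards [Lp.coeFn_smul c f, e] with z h a
    rw [h, Pi.smul_apply, Pi.smul_apply, a]

/-- Mean value inequality over circles, in terms of lower integrals. -/
theorem bergman_circle_bound {g : ℂ → ℂ} {c : ℂ} {R r : ℝ} (hr : 0 < r) (hrR : r < R)
    (hg : DifferentiableOn ℂ g (ball c R)) :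
    ENNReal.ofReal (2 * Real.pi) * ‖g c‖ₑ ≤
      ∫⁻ θ in Set.Ioo (-Real.pi) Real.pi, ‖g (c + Complex.polarCoord.symm (r, θ))‖ₑ := by
  have hd : DiffContOnCl ℂ g (ball c |r|) := by
    apply DifferentiableOn.diffContOnCl
    refine hg.mono (closure_ball_subset_closedBall.trans ?_)
    rw [abs_of_pos hr]
    exact closedBall_subset_ball hrR
  have hm := hd.circleAverage
  have h2 : (2 * Real.pi : ℝ) • g c = ∫ θ in (-Real.pi)..Real.pi, g (circleMap c r θ) := by
    rw [← hm, Real.circleAverage, smul_smul, mul_inv_cancel₀ (by positivity), one_smul]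
    have hp : Function.Periodic (fun θ => g (circleMap c r θ)) (2 * Real.pi) := by
      intro θ
      simp only [periodic_circleMap c r θ]
    have := hp.intervalIntegral_add_eq 0 (-Real.pi)
    rw [zero_add] at this
    rw [this]
    congr 1
    ring
  have h3 : ‖(2 * Real.pi : ℝ) • g c‖ₑ = ENNReal.ofReal (2 * Real.pi) * ‖g c‖ₑ := by
    rw [enorm_smul, Real.enorm_eq_ofReal (by positivity)]
  rw [← h3, h2, intervalIntegral.integral_of_le (by linarith [Real.pi_pos]),
    integral_Ioc_eq_integral_Ioo]
  refine (enorm_integral_le_lintegral_enorm _).trans (le_of_eq ?_)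
  congr 1
  ext θ
  congr 2
  simp [circleMap, Complex.exp_mul_I]

/-- Mean value inequality over disks. -/
theorem bergman_area_bound {g : ℂ → ℂ} {c : ℂ} {R : ℝ} (hR : 0 < R)
    (hg : DifferentiableOn ℂ g (ball c R)) :
    ENNReal.ofReal (R / 4) * ENNReal.ofReal (R / 2) * ‖g c‖ₑ ≤ ∫⁻ z in ball c R, ‖g z‖ₑ := by
  set F : ℂ → ℝ≥0∞ := (ball (0 : ℂ) R).indicator fun z => ‖g (c + z)‖ₑ with hF
  have hcont : ContinuousOn (fun z => ‖g (c + z)‖ₑ) (ball (0 : ℂ) R) := by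
    refine continuous_enorm.comp_continuousOn (hg.continuousOn.comp (by fun_prop) ?_)
    intro z hz
    simpa using hz
  have hFm : Measurable F := by
    classical
    rw [hF, ← Set.piecewise_eq_indicator]
    exact hcont.measurable_piecewise continuousOn_const isOpen_ball.measurableSet
  have e1 : ∫⁻ z in ball c R, ‖g z‖ₑ = ∫⁻ z, F z := by
    rw [hF, lintegral_indicator isOpen_ball.measurableSet,
      ← lintegral_indicator isOpen_ball.measurableSet,
      ← lintegral_indicator isOpen_ball.measurableSet,
      ← lintegral_add_left_eq_self _ c]
    congr 1
    ext z
    by_cases hz : z ∈ ball (0 : ℂ) R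
    · have : c + z ∈ ball c R := by simpa using hz
      rw [Set.indicator_of_mem hz, Set.indicator_of_mem this]
    · have : c + z ∉ ball c R := by simpa using hz
      rw [Set.indicator_of_notMem hz, Set.indicator_of_notMem this]
  have hsymm : Measurable fun p : ℝ × ℝ => Complex.polarCoord.symm p := by
    simp only [Complex.polarCoord_symm_apply]
    fun_prop
  have hm2 : Measurable fun p : ℝ × ℝ =>
      ENNReal.ofReal p.1 * F (Complex.polarCoord.symm p) :=
    (ENNReal.measurable_ofReal.comp measurable_fst).mul (hFm.comp hsymm)
  rw [e1, ← Complex.lintegral_comp_polarCoord_symm, polarCoord_target]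
  simp only [smul_eq_mul]
  rw [Measure.volume_eq_prod, ← Measure.prod_restrict, lintegral_prod _ hm2.aemeasurable]
  have key : ∀ r ∈ Set.Ioo (R / 2) R, ENNReal.ofReal (R / 2) * ‖g c‖ₑ ≤
      ∫⁻ θ in Set.Ioo (-Real.pi) Real.pi,
        ENNReal.ofReal r * F (Complex.polarCoord.symm (r, θ)) := by
    intro r hr
    have hr0 : 0 < r := by linarith [hr.1]
    have hm3 : Measurable fun θ : ℝ => F (Complex.polarCoord.symm (r, θ)) :=
      (hFm.comp hsymm).comp measurable_prodMk_left
    rw [lintegral_const_mul _ hm3]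
    refine mul_le_mul' (ENNReal.ofReal_le_ofReal hr.1.le) ?_
    have hb := bergman_circle_bound hr0 hr.2 hg
    have hone : ‖g c‖ₑ ≤ ENNReal.ofReal (2 * Real.pi) * ‖g c‖ₑ := by
      nth_rw 1 [← one_mul ‖g c‖ₑ]
      refine mul_le_mul_left ?_ _
      rw [ENNReal.one_le_ofReal]
      linarith [Real.pi_gt_three]
    refine (hone.trans hb).trans (le_of_eq ?_)
    congr 1
    ext θ
    rw [hF, Set.indicator_of_mem]
    rw [mem_ball_zero_iff, Complex.norm_polarCoord_symm, abs_of_pos hr0]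
    exact hr.2
  calc ENNReal.ofReal (R / 4) * ENNReal.ofReal (R / 2) * ‖g c‖ₑ
      ≤ ∫⁻ _ in Set.Ioo (R / 2) R, ENNReal.ofReal (R / 2) * ‖g c‖ₑ := by
        rw [setLIntegral_const, Real.volume_Ioo, mul_assoc, mul_comm]
        gcongr
        linarith
    _ ≤ ∫⁻ r in Set.Ioo (R / 2) R, ∫⁻ θ in Set.Ioo (-Real.pi) Real.pi,
        ENNReal.ofReal r * F (Complex.polarCoord.symm (r, θ)) :=
        setLIntegral_mono' measurableSet_Ioo key
    _ ≤ _ := lintegral_mono_set fun r hr => by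
        have := hr.1
        simp only [Set.mem_Ioi]
        linarith

theorem diskMeasure_apply_le (c : ℂ) (R : ℝ) (h : ball c R ⊆ ball 0 1) (F : ℂ → ℝ≥0∞) :
    ∫⁻ z in ball c R, F z ≤ ENNReal.ofReal Real.pi * ∫⁻ z, F z ∂diskMeasure := by
  rw [diskMeasure, lintegral_smul_measure, smul_eq_mul, ← mul_assoc, ENNReal.mul_inv_cancel,
    one_mul]
  · exact lintegral_mono_set h
  · simp [Real.pi_pos]
  · exact ENNReal.ofReal_ne_top

/-- Point evaluations are bounded, uniformly on smaller disks. -/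
theorem bergman_eval_bound {ρ : ℝ} (hρ : ρ < 1) :
    ∃ C : ℝ, 0 < C ∧ ∀ (f : Lp ℂ 2 diskMeasure) (g : ℂ → ℂ), DifferentiableOn ℂ g (ball 0 1) →
      f =ᵐ[diskMeasure] g → ∀ c ∈ ball (0 : ℂ) ρ, ‖g c‖ ≤ C * ‖f‖ := by
  set R : ℝ := 1 - ρ with hRdef
  have hR : 0 < R := by linarith
  set K : ℝ := R / 4 * (R / 2) with hK
  have hK0 : 0 < K := by positivity
  refine ⟨Real.sqrt (Real.pi / K), by positivity, fun f g hg hfg c hc => ?_⟩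
  have hsub : ball c R ⊆ ball 0 1 := by
    intro z hz
    rw [mem_ball_zero_iff] at *
    rw [mem_ball, dist_eq_norm] at hz
    calc ‖z‖ = ‖(z - c) + c‖ := by ring_nf
      _ ≤ ‖z - c‖ + ‖c‖ := norm_add_le _ _
      _ < 1 := by linarith
  have h1 := bergman_area_bound (g := fun z => g z ^ 2) hR ((hg.mono hsub).pow 2)
  have h2 := h1.trans (diskMeasure_apply_le c R hsub _)
  have h3 : ∫⁻ z, ‖g z ^ 2‖ₑ ∂diskMeasure = ‖f‖ₑ ^ 2 := by
    rw [Lp.enorm_def, eLpNorm_congr_ae hfg,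
      eLpNorm_eq_lintegral_rpow_enorm_toReal (by norm_num) (by norm_num),
      ← ENNReal.rpow_natCast, ← ENNReal.rpow_mul]
    simp [enorm_pow]
  rw [h3, ← ENNReal.ofReal_mul (by positivity), enorm_pow, ← ofReal_norm, ← ofReal_norm,
    ← ENNReal.ofReal_pow (norm_nonneg _), ← ENNReal.ofReal_pow (norm_nonneg _),
    ← ENNReal.ofReal_mul (by positivity), ← ENNReal.ofReal_mul (by positivity),
    ENNReal.ofReal_le_ofReal_iff (by positivity)] at h2
  refine (sq_le_sq₀ (norm_nonneg _) (by positivity)).mp ?_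
  rw [mul_pow, Real.sq_sqrt (by positivity), div_mul_eq_mul_div, le_div_iff₀ hK0, mul_comm]
  exact h2

theorem isClosed_bergmanSpace : IsClosed (bergmanSpace : Set (Lp ℂ 2 diskMeasure)) := by
  apply IsSeqClosed.isClosed
  intro f F hf hF
  choose g hg hfg using hf
  have hdiff : ∀ n k, (f n - f k : Lp ℂ 2 diskMeasure) =ᵐ[diskMeasure] g n - g k := by
    intro n k
    filter_upwards [Lp.coeFn_sub (f n) (f k), hfg n, hfg k] with z h a b
    rw [h, Pi.sub_apply, Pi.sub_apply, a, b]
  have hcau : CauchySeq f := hF.cauchySeq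
  have huc : ∀ ρ < (1 : ℝ), UniformCauchySeqOn g atTop (ball (0 : ℂ) ρ) := by
    intro ρ hρ
    obtain ⟨C, hC, hb⟩ := bergman_eval_bound hρ
    rw [Metric.uniformCauchySeqOn_iff]
    intro ε hε
    obtain ⟨N, hN⟩ := Metric.cauchySeq_iff.mp hcau (ε / C) (by positivity)
    refine ⟨N, fun n hn k hk z hz => ?_⟩
    have h1 := hb (f n - f k) (g n - g k) ((hg n).sub (hg k)) (hdiff n k) z hz
    have h2 := hN n hn k hk
    rw [dist_eq_norm] at h2 ⊢
    calc ‖g n z - g k z‖ ≤ C * ‖f n - f k‖ := h1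
      _ < C * (ε / C) := by gcongr
      _ = ε := by field_simp
  have hlim : ∀ z : ℂ, ∃ w, z ∈ ball (0 : ℂ) 1 → Tendsto (fun n => g n z) atTop (𝓝 w) := by
    intro z
    by_cases hz : z ∈ ball (0 : ℂ) 1
    · obtain ⟨ρ, h1, h2⟩ := exists_between (mem_ball_zero_iff.mp hz)
      have hc : CauchySeq fun n => g n z :=
        (huc ρ h2).cauchySeq (mem_ball_zero_iff.mpr h1)
      obtain ⟨w, hw⟩ := cauchySeq_tendsto_of_complete hc
      exact ⟨w, fun _ => hw⟩
    · exact ⟨0, fun h => absurd h hz⟩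
  choose G hG using hlim
  have hloc : TendstoLocallyUniformlyOn g G atTop (ball (0 : ℂ) 1) := by
    intro u hu z hz
    obtain ⟨ρ, h1, h2⟩ := exists_between (mem_ball_zero_iff.mp hz)
    have ht : TendstoUniformlyOn g G atTop (ball (0 : ℂ) ρ) :=
      (huc ρ h2).tendstoUniformlyOn_of_tendsto fun w hw =>
        hG w (ball_subset_ball h2.le hw)
    exact ⟨ball 0 ρ, mem_nhdsWithin_of_mem_nhds
      (isOpen_ball.mem_nhds (mem_ball_zero_iff.mpr h1)), ht u hu⟩
  refine ⟨G, hloc.differentiableOn (Eventually.of_forall hg) isOpen_ball, ?_⟩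
  obtain ⟨ns, hns, hae⟩ := (tendstoInMeasure_of_tendsto_Lp hF).exists_seq_tendsto_ae
  have hball : ∀ᵐ z ∂diskMeasure, z ∈ ball (0 : ℂ) 1 :=
    Measure.ae_smul_measure (ae_restrict_mem isOpen_ball.measurableSet) _
  filter_upwards [hae, hball, ae_all_iff.mpr hfg] with z h1 h2 h3
  refine tendsto_nhds_unique h1 ?_
  simp only [h3]
  exact (hG z h2).comp hns.tendsto_atTop

instance : CompleteSpace bergmanSpace := isClosed_bergmanSpace.completeSpace_coe

/-- The Toeplitz operator `T_φ f = P (φ f)` on the Bergman space with symbol `φ ∈ L^∞(𝔻, dA)`: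
multiplication by `φ` on `L²(𝔻, dA)`, followed by the orthogonal projection `P` onto the Bergman
space. -/
noncomputable def toeplitz (φ : Lp ℂ ∞ diskMeasure) : bergmanSpace →L[ℂ] bergmanSpace :=
  bergmanSpace.orthogonalProjectionOnto ∘L
    (ContinuousLinearMap.mul ℂ ℂ).holderL diskMeasure ∞ 2 2 φ ∘L bergmanSpace.subtypeL

/-- The function `φ(z) = z̄^m + α z^m + β`. -/
noncomputable def harmonicSymbol (m : ℕ) (α β z : ℂ) : ℂ := conj z ^ m + α * z ^ m + β

theorem memLp_harmonicSymbol (m : ℕ) (α β : ℂ) : MemLp (harmonicSymbol m α β) ∞ diskMeasure := by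
  have hc : Continuous (harmonicSymbol m α β) := by
    unfold harmonicSymbol
    fun_prop
  refine memLp_top_of_bound hc.aestronglyMeasurable (1 + ‖α‖ + ‖β‖) ?_
  have hball : ∀ᵐ z ∂diskMeasure, z ∈ ball (0 : ℂ) 1 :=
    Measure.ae_smul_measure (ae_restrict_mem isOpen_ball.measurableSet) _
  filter_upwards [hball] with z hz
  have h1 : ‖z‖ ^ m ≤ 1 := pow_le_one₀ (norm_nonneg _) (mem_ball_zero_iff.mp hz).le
  calc ‖conj z ^ m + α * z ^ m + β‖ ≤ ‖conj z ^ m + α * z ^ m‖ + ‖β‖ := norm_add_le _ _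
    _ ≤ ‖conj z ^ m‖ + ‖α * z ^ m‖ + ‖β‖ := by gcongr; exact norm_add_le _ _
    _ = ‖z‖ ^ m + ‖α‖ * ‖z‖ ^ m + ‖β‖ := by simp
    _ ≤ 1 + ‖α‖ * 1 + ‖β‖ := by gcongr
    _ = 1 + ‖α‖ + ‖β‖ := by ring

/-- The Toeplitz operator with symbol `z̄^m + α z^m + β`. -/
noncomputable def harmonicToeplitz (m : ℕ) (α β : ℂ) : bergmanSpace →L[ℂ] bergmanSpace :=
  toeplitz (memLp_harmonicSymbol m α β).toLp

/-- The index `dim ker T - dim coker T` of a Fredholm operator. -/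
noncomputable def fredholmIndex {E F : Type*} [NormedAddCommGroup E] [NormedSpace ℂ E]
    [NormedAddCommGroup F] [NormedSpace ℂ F] (T : E →L[ℂ] F) : ℤ :=
  (Module.finrank ℂ T.ker : ℤ) - (Module.finrank ℂ (F ⧸ T.range) : ℤ)

/-- The winding number `(2πi)⁻¹ ∫_γ dζ / (ζ - w)` about `w` of the closed curve
`θ ↦ φ (e^{iθ})`, `0 ≤ θ ≤ 2π`. It is used for `φ` smooth and `w` off the curve. -/
noncomputable def windingNumber (φ : ℂ → ℂ) (w : ℂ) : ℂ :=
  (2 * Real.pi * Complex.I)⁻¹ * ∫ θ in (0 : ℝ)..(2 * Real.pi),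
    deriv (fun t : ℝ => φ (circleMap 0 1 t)) θ / (φ (circleMap 0 1 θ) - w)

/-! In the orthonormal basis `√(n + 1) z ^ n` multiplication by `z ^ m` is a weighted shift `S = F
J`: `F` is the isometric shift by `m` places and `J` a diagonal operator whose weights tend to `1`.
Hence `T_φ - w` has the matrix `S† + α S + c` with `c = β - w`.

Suppose first `|α| < 1`. Since `S† = J F†` and `F† F = 1`, this matrix equals `J F† L` with `L = 1 +
F J⁻¹ (α S + c)`. If `J` were the identity, `L` would be `1 + c F + α F² = (1 - μ F) (1 - ν F)`,
where `μ ν = α` and `μ + ν = -c`. For `w = conj u + α u + β` with `|u| < 1` both `μ` and `ν` lie in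
the open disk (`exists_roots_of_norm_lt_one`), so this product is invertible. The error made is
strictly lower triangular and small on vectors supported far out; such a perturbation keeps `L`
invertible, because a power of the relative error has norm below `1` (`isUnit_one_add`,
`isUnit_lowerFactor`). Thus `T_φ - w` is right invertible with kernel isomorphic to that of `F†`,
and its index is `m`. The same factorization on the circle, `φ - w = q⁻¹ (1 - μ q) (1 - ν q)` with
`q = z ^ m`, gives winding number `-m`.

The case `|α| > 1` reduces to `1 / conj α`, by adjoints for the operator and by conjugation for the
curve; both signs change. A nonzero index excludes invertibility, and `|α| = 1` follows by
approximation, since the non-invertible operators form a closed set. -/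

/-! ### Triangular operators on `ℓ²(ℕ)` -/

/-- The Hilbert space `ℓ²(ℕ)`. -/
abbrev SqSummable : Type := lp (fun _ : ℕ => ℂ) 2

/-- The coordinates of `x` below `M` vanish. -/
def VanishesBelow (M : ℕ) (x : SqSummable) : Prop := ∀ i < M, x i = 0

/-- `T` raises the order of vanishing by at least `k`. -/
def IsLowerTriangular (k : ℕ) (T : SqSummable →L[ℂ] SqSummable) : Prop :=
  ∀ M x, VanishesBelow M x → VanishesBelow (M + k) (T x)

/-- The norm of the restriction of `T` to the vectors vanishing below `M` tends to `0`. -/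
def IsAsymptoticallySmall (T : SqSummable →L[ℂ] SqSummable) : Prop :=
  ∀ ε > 0, ∃ M, ∀ x, VanishesBelow M x → ‖T x‖ ≤ ε * ‖x‖

theorem VanishesBelow.mono {M N : ℕ} {x : SqSummable} (h : VanishesBelow N x) (hMN : M ≤ N) :
    VanishesBelow M x := fun i hi => h i (hi.trans_le hMN)

namespace IsLowerTriangular

variable {j k : ℕ} {S T : SqSummable →L[ℂ] SqSummable}

theorem mono (hT : IsLowerTriangular k T) (h : j ≤ k) : IsLowerTriangular j T :=
  fun M x hx => (hT M x hx).mono (by omega)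

theorem comp (hS : IsLowerTriangular j S) (hT : IsLowerTriangular k T) :
    IsLowerTriangular (j + k) (S * T) := fun M x hx => by
  have := hS _ _ (hT M x hx)
  exact this.mono (by omega)

theorem add (hS : IsLowerTriangular k S) (hT : IsLowerTriangular k T) :
    IsLowerTriangular k (S + T) := fun M x hx i hi => by
  simp [hS M x hx i hi, hT M x hx i hi]

theorem smul (hT : IsLowerTriangular k T) (c : ℂ) : IsLowerTriangular k (c • T) :=
  fun M x hx i hi => by simp [hT M x hx i hi]

theorem sub (hS : IsLowerTriangular k S) (hT : IsLowerTriangular k T) :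
    IsLowerTriangular k (S - T) := fun M x hx i hi => by
  simp [hS M x hx i hi, hT M x hx i hi]

theorem one : IsLowerTriangular 0 1 := fun _ _ hx => hx

theorem pow (hT : IsLowerTriangular 1 T) (n : ℕ) : IsLowerTriangular n (T ^ n) := by
  induction n with
  | zero => exact one
  | succ n ih => rw [pow_succ]; exact ih.comp hT

/-- Solving a unipotent triangular system preserves the order of vanishing. -/
theorem of_one_sub_mul_eq_one (hS : IsLowerTriangular 1 S) (h : (1 - S) * T = 1) :
    IsLowerTriangular 0 T := by
  intro M x hx
  have hy : T x = x + S (T x) := by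
    have := congrArg (fun A : SqSummable →L[ℂ] SqSummable => A x) h
    simp only [mul_apply_eq_comp, sub_apply,
      one_apply_eq_self] at this
    rw [sub_eq_iff_eq_add] at this
    exact this
  -- In `T x = x + S (T x)`, vanishing of `T x` below `k` makes `S (T x)` vanish below `k + 1`; the
  -- order thus climbs one step at a time until `x` limits it at `M`.
  have key : ∀ k ≤ M, VanishesBelow k (T x) := by
    intro k
    induction k with
    | zero => intro _ i hi; omega
    | succ k ih =>
      intro hk i hi
      rw [hy, lp.coeFn_add, Pi.add_apply, hx i (by omega), hS k _ (ih (by omega)) i hi, add_zero]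
  exact key M le_rfl

end IsLowerTriangular

namespace IsAsymptoticallySmall

variable {S T : SqSummable →L[ℂ] SqSummable}

theorem add (hS : IsAsymptoticallySmall S) (hT : IsAsymptoticallySmall T) :
    IsAsymptoticallySmall (S + T) := by
  intro ε hε
  obtain ⟨M, hM⟩ := hS (ε / 2) (by positivity)
  obtain ⟨N, hN⟩ := hT (ε / 2) (by positivity)
  refine ⟨max M N, fun x hx => ?_⟩
  calc ‖(S + T) x‖ ≤ ‖S x‖ + ‖T x‖ := norm_add_le _ _
    _ ≤ ε / 2 * ‖x‖ + ε / 2 * ‖x‖ :=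
      add_le_add (hM x (hx.mono (le_max_left _ _))) (hN x (hx.mono (le_max_right _ _)))
    _ = ε * ‖x‖ := by ring

theorem mul_left (hT : IsAsymptoticallySmall T) (S : SqSummable →L[ℂ] SqSummable) :
    IsAsymptoticallySmall (S * T) := by
  intro ε hε
  obtain ⟨M, hM⟩ := hT (ε / (‖S‖ + 1)) (by positivity)
  refine ⟨M, fun x hx => ?_⟩
  calc ‖S (T x)‖ ≤ ‖S‖ * ‖T x‖ := S.le_opNorm _
    _ ≤ (‖S‖ + 1) * (ε / (‖S‖ + 1) * ‖x‖) := by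
      gcongr
      · linarith
      · exact hM x hx
    _ = ε * ‖x‖ := by field_simp

/-- Unlike for `mul_left`, triangularity is needed: `T x` must still vanish below `M` before the
bound on `S` applies. -/
theorem mul_right (hS : IsAsymptoticallySmall S) (hT : IsLowerTriangular 0 T) :
    IsAsymptoticallySmall (S * T) := by
  intro ε hε
  obtain ⟨M, hM⟩ := hS (ε / (‖T‖ + 1)) (by positivity)
  refine ⟨M, fun x hx => ?_⟩
  calc ‖S (T x)‖ ≤ ε / (‖T‖ + 1) * ‖T x‖ := hM _ (hT M x hx)
    _ ≤ ε / (‖T‖ + 1) * ((‖T‖ + 1) * ‖x‖) := by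
      gcongr
      refine (T.le_opNorm _).trans ?_
      gcongr
      linarith
    _ = ε * ‖x‖ := by field_simp

theorem smul (hT : IsAsymptoticallySmall T) (c : ℂ) : IsAsymptoticallySmall (c • T) := by
  have := hT.mul_left (c • 1)
  rwa [smul_one_mul] at this

/-- The operator `1 + T` is invertible if `T` is strictly lower triangular and asymptotically
small: a power of `T` has norm less than `1`. -/
theorem isUnit_one_add (hT : IsAsymptoticallySmall T) (hl : IsLowerTriangular 1 T) :
    IsUnit (1 + T) := by
  obtain ⟨M, hM⟩ := hT (1 / 2) (by norm_num)
  have hpow : ∀ k x, VanishesBelow M x → ‖(T ^ k) x‖ ≤ (1 / 2) ^ k * ‖x‖ := by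
    intro k
    induction k with
    | zero => intro x _; simp
    | succ k ih =>
      intro x hx
      rw [pow_succ', mul_apply_eq_comp]
      calc ‖T ((T ^ k) x)‖ ≤ 1 / 2 * ‖(T ^ k) x‖ :=
            hM _ (((hl.pow k) M x hx).mono (by omega))
        _ ≤ 1 / 2 * ((1 / 2) ^ k * ‖x‖) := by gcongr; exact ih x hx
        _ = (1 / 2) ^ (k + 1) * ‖x‖ := by ring
  -- `T ^ M` sends every vector to one vanishing below `M`, and each further application of `T` at
  -- least halves the norm. So `‖T ^ (k + M)‖ ≤ 2⁻ᵏ ‖T ^ M‖`, and `k` is chosen to bring this below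
  -- `1`.
  obtain ⟨k, hk⟩ := exists_pow_lt_of_lt_one (show (0 : ℝ) < 1 / (‖T ^ M‖ + 1) by positivity)
    (show (1 / 2 : ℝ) < 1 by norm_num)
  have hn : ‖T ^ (k + M)‖ < 1 := by
    have hlt : (1 / 2) ^ k * ‖T ^ M‖ < 1 := by
      rw [lt_div_iff₀ (by positivity)] at hk
      have : (0 : ℝ) < (1 / 2) ^ k := by positivity
      nlinarith
    refine lt_of_le_of_lt (ContinuousLinearMap.opNorm_le_bound _ (by positivity) fun x => ?_) hlt
    rw [pow_add, mul_apply_eq_comp]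
    calc ‖(T ^ k) ((T ^ M) x)‖ ≤ (1 / 2) ^ k * ‖(T ^ M) x‖ :=
          hpow k _ (((hl.pow M) 0 x (fun i hi => by omega)).mono (by omega))
      _ ≤ (1 / 2) ^ k * (‖T ^ M‖ * ‖x‖) := by gcongr; exact (T ^ M).le_opNorm x
      _ = (1 / 2) ^ k * ‖T ^ M‖ * ‖x‖ := by ring
  have hu : IsUnit (1 - (-T) ^ (k + M)) := by
    apply isUnit_one_sub_of_norm_lt_one
    rw [neg_pow]
    rcases neg_one_pow_eq_or (SqSummable →L[ℂ] SqSummable) (k + M) with h | h <;> rw [h]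
    · rwa [one_mul]
    · rwa [neg_one_mul, norm_neg]
  -- The finite geometric sum in `-T` commutes with `1 + T`, and their product is the unit `1 - (-T)
  -- ^ (k + M)`; hence both factors are units.
  have h1 := Commute.isUnit_mul_iff (a := ∑ i ∈ Finset.range (k + M), (-T) ^ i) (b := 1 - -T)
    (Commute.sum_left _ _ _ fun i _ =>
      ((Commute.one_right _).sub_right ((Commute.refl _).pow_left _)))
  rw [geom_sum_mul_neg] at h1
  simpa using (h1.mp hu).2

end IsAsymptoticallySmall

/-! ### Shifts and diagonal operators -/

/-- The unweighted forward shift by `m` places. -/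
noncomputable def shiftIsometry (m : ℕ) : SqSummable →ₗᵢ[ℂ] SqSummable where
  toFun x := ⟨fun n => if m ≤ n then x (n - m) else 0, by
    have hx := (lp.memℓp x).summable (by norm_num)
    refine memℓp_gen ((summable_nat_add_iff m).mp ?_)
    simpa using hx⟩
  map_add' x y := by
    ext n
    change (if m ≤ n then (x + y) (n - m) else 0) =
      (if m ≤ n then x (n - m) else 0) + if m ≤ n then y (n - m) else 0
    by_cases h : m ≤ n <;> simp [h]
  map_smul' c x := by ext n; by_cases h : m ≤ n <;> simp [h]
  norm_map' x := by
    have h2 : (0 : ℝ) < (2 : ℝ≥0∞).toReal := by norm_num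
    refine (Real.rpow_left_inj (norm_nonneg _) (norm_nonneg _) h2.ne').mp ?_
    have hs : Summable fun n => ‖(if m ≤ n then x (n - m) else 0 : ℂ)‖ ^ (2 : ℝ≥0∞).toReal := by
      refine (summable_nat_add_iff m).mp ?_
      simpa using (lp.memℓp x).summable (by norm_num)
    rw [lp.norm_rpow_eq_tsum h2, lp.norm_rpow_eq_tsum h2]
    simp only [LinearMap.coe_mk, AddHom.coe_mk]
    rw [← hs.sum_add_tsum_nat_add m, Finset.sum_eq_zero, zero_add]
    · simp
    · intro i hi
      have : ¬ m ≤ i := by simpa using hi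
      simp [this]

/-- The unweighted forward shift by `m` places, as a bounded operator. -/
noncomputable def forwardShift (m : ℕ) : SqSummable →L[ℂ] SqSummable :=
  (shiftIsometry m).toContinuousLinearMap

theorem forwardShift_apply (m : ℕ) (x : SqSummable) (n : ℕ) :
    forwardShift m x n = if m ≤ n then x (n - m) else 0 := rfl

theorem forwardShift_single (m n : ℕ) (a : ℂ) :
    forwardShift m (lp.single 2 n a) = lp.single 2 (n + m) a := by
  ext k
  rw [forwardShift_apply]
  by_cases h : m ≤ k
  · by_cases h' : k = n + m
    · subst h'; simp
    · rw [if_pos h, lp.single_apply_ne _ _ _ h', lp.single_apply_ne _ _ _ (by omega)]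
  · rw [if_neg h, lp.single_apply_ne _ _ _ (by omega)]

theorem norm_forwardShift_le (m : ℕ) : ‖forwardShift m‖ ≤ 1 :=
  (shiftIsometry m).norm_toContinuousLinearMap_le

theorem isLowerTriangular_forwardShift (m : ℕ) : IsLowerTriangular m (forwardShift m) := by
  intro M x hx i hi
  rw [forwardShift_apply]
  split_ifs with h
  · exact hx _ (by omega)
  · rfl

theorem adjoint_forwardShift_apply (m : ℕ) (x : SqSummable) (n : ℕ) :
    (forwardShift m).adjoint x n = x (n + m) := by
  have h1 := lp.inner_single_left (𝕜 := ℂ) (G := fun _ : ℕ => ℂ) n (1 : ℂ)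
    ((forwardShift m).adjoint x)
  have h2 := lp.inner_single_left (𝕜 := ℂ) (G := fun _ : ℕ => ℂ) (n + m) (1 : ℂ) x
  rw [ContinuousLinearMap.adjoint_inner_right, forwardShift_single, h2] at h1
  simpa using h1.symm

theorem adjoint_forwardShift_mul (m : ℕ) : (forwardShift m).adjoint * forwardShift m = 1 := by
  ext x n
  simp [adjoint_forwardShift_apply, forwardShift_apply]

/-- The kernel of the backward shift consists of the sequences supported in `{0, …, m - 1}`. -/
noncomputable def kerBackwardShiftEquiv (m : ℕ) :
    (forwardShift m).adjoint.ker ≃ₗ[ℂ] (Fin m → ℂ) :=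
  LinearEquiv.ofBijective
    ({ toFun := fun x i => (x : SqSummable) i
       map_add' := fun x y => by ext i; simp
       map_smul' := fun c x => by ext i; simp } :
      (forwardShift m).adjoint.ker →ₗ[ℂ] (Fin m → ℂ)) <| by
    constructor
    · intro x y hxy
      ext n
      by_cases hn : n < m
      · exact congrFun hxy ⟨n, hn⟩
      · have key : ∀ z : (forwardShift m).adjoint.ker, (z : SqSummable) n = 0 := fun z => by
          have hz : (forwardShift m).adjoint (z : SqSummable) = 0 := z.2
          have := adjoint_forwardShift_apply m z (n - m)
          rw [hz, Nat.sub_add_cancel (by omega)] at this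
          simpa using this.symm
        exact (key x).trans (key y).symm
    · intro v
      have hmem : (⟨fun n => if h : n < m then v ⟨n, h⟩ else 0, by
          refine memℓp_gen (summable_of_ne_finset_zero (s := Finset.range m) fun n hn => ?_)
          have : ¬ n < m := by simpa using hn
          simp [this]⟩ : SqSummable) ∈ (forwardShift m).adjoint.ker := by
        change (forwardShift m).adjoint _ = 0
        ext n
        rw [adjoint_forwardShift_apply]
        simp
      refine ⟨⟨_, hmem⟩, ?_⟩
      ext i
      simp

/-- The diagonal operator with entries `d n`. -/
noncomputable def diagonalOperator (d : ℕ → ℂ) {K : ℝ} (hd : ∀ n, ‖d n‖ ≤ K) :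
    SqSummable →L[ℂ] SqSummable :=
  lp.mapCLM 2 (fun n => d n • ContinuousLinearMap.id ℂ ℂ) ((norm_nonneg _).trans (hd 0))
    fun n => by
      rw [norm_smul, ContinuousLinearMap.norm_id, mul_one]
      exact hd n

@[simp]
theorem diagonalOperator_apply (d : ℕ → ℂ) {K : ℝ} (hd : ∀ n, ‖d n‖ ≤ K) (x : SqSummable) (n : ℕ) :
    diagonalOperator d hd x n = d n * x n := by
  simp [diagonalOperator]

theorem isLowerTriangular_diagonalOperator (d : ℕ → ℂ) {K : ℝ} (hd : ∀ n, ‖d n‖ ≤ K) :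
    IsLowerTriangular 0 (diagonalOperator d hd) := by
  intro M x hx i hi
  rw [diagonalOperator_apply, hx i hi, mul_zero]

theorem isAsymptoticallySmall_diagonalOperator {d : ℕ → ℂ} {K : ℝ} (hd : ∀ n, ‖d n‖ ≤ K)
    (h0 : Tendsto d atTop (𝓝 0)) : IsAsymptoticallySmall (diagonalOperator d hd) := by
  intro ε hε
  obtain ⟨M, hM⟩ := Metric.tendsto_atTop.mp h0 ε hε
  refine ⟨M, fun x hx => ?_⟩
  have : ‖diagonalOperator d hd x‖ ≤ ‖(ε : ℂ) • x‖ := by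
    refine lp.norm_mono (by norm_num) fun n => ?_
    rw [diagonalOperator_apply, lp.coeFn_smul, Pi.smul_apply, smul_eq_mul, norm_mul, norm_mul]
    by_cases hn : n < M
    · simp [hx n hn]
    · have := hM n (by omega)
      rw [dist_zero_right] at this
      gcongr
      rw [Complex.norm_real]
      exact this.le.trans (le_abs_self _)
  rwa [norm_smul, Complex.norm_real, Real.norm_of_nonneg hε.le] at this

theorem adjoint_diagonalOperator_ofReal (d : ℕ → ℝ) {K : ℝ} (hd : ∀ n, ‖(d n : ℂ)‖ ≤ K) :
    (diagonalOperator (fun n => (d n : ℂ)) hd).adjoint = diagonalOperator (fun n => (d n : ℂ)) hd := by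
  rw [eq_comm, ContinuousLinearMap.eq_adjoint_iff]
  intro x y
  rw [lp.inner_eq_tsum, lp.inner_eq_tsum]
  congr 1
  ext n
  simp
  ring

/-! ### The operator `S† + α S + c` for the Bergman shift `S` -/

/-- The weights of multiplication by `z ^ m` in the orthonormal basis `√(n + 1) z ^ n`. -/
noncomputable def bergmanWeight (m n : ℕ) : ℝ := Real.sqrt ((n + 1) / (n + m + 1))

theorem bergmanWeight_pos (m n : ℕ) : 0 < bergmanWeight m n := by
  unfold bergmanWeight
  positivity

theorem bergmanWeight_le_one (m n : ℕ) : bergmanWeight m n ≤ 1 := by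
  unfold bergmanWeight
  rw [Real.sqrt_le_left zero_le_one, one_pow, div_le_one (by positivity)]
  linarith [(Nat.cast_nonneg m : (0 : ℝ) ≤ m)]

/-- The square of the left side is `1 + m / (n + 1)`. Any bound uniform in `n` would do; it makes
`J⁻¹` a bounded operator. -/
theorem inv_bergmanWeight_le (m n : ℕ) : (bergmanWeight m n)⁻¹ ≤ m + 1 := by
  have hm : (0 : ℝ) ≤ m := Nat.cast_nonneg m
  have hn : (0 : ℝ) ≤ n := Nat.cast_nonneg n
  unfold bergmanWeight
  rw [← Real.sqrt_inv, inv_div]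
  rw [Real.sqrt_le_left (by positivity), div_le_iff₀ (by positivity)]
  nlinarith [mul_nonneg hm hn, mul_nonneg hm hm, mul_nonneg (mul_nonneg hm hm) hn]

theorem tendsto_bergmanWeight (m : ℕ) : Tendsto (bergmanWeight m) atTop (𝓝 1) := by
  have h : Tendsto (fun n : ℕ => ((n : ℝ) + 1) / (n + m + 1)) atTop (𝓝 1) := by
    have := (tendsto_const_div_atTop_nhds_zero_nat (m : ℝ)).comp (tendsto_add_atTop_nat (m + 1))
    have h2 := this.const_sub 1
    rw [sub_zero] at h2
    refine h2.congr fun n => ?_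
    have : ((n : ℝ) + m + 1) ≠ 0 := by positivity
    simp only [Function.comp_apply, Nat.cast_add, Nat.cast_one]
    rw [← add_assoc]
    field_simp
    ring
  rw [← Real.sqrt_one]
  exact h.sqrt

/-- The diagonal operator of the Bergman weights. -/
noncomputable def weightOperator (m : ℕ) : SqSummable →L[ℂ] SqSummable :=
  diagonalOperator (K := 1) (fun n => (bergmanWeight m n : ℂ)) fun n => by
    rw [Complex.norm_real, Real.norm_of_nonneg (bergmanWeight_pos m n).le]
    exact bergmanWeight_le_one m n

/-- The inverse of the diagonal operator of the Bergman weights. -/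
noncomputable def invWeightOperator (m : ℕ) : SqSummable →L[ℂ] SqSummable :=
  diagonalOperator (K := m + 1) (fun n => (bergmanWeight m n : ℂ)⁻¹) fun n => by
    rw [norm_inv, Complex.norm_real, Real.norm_of_nonneg (bergmanWeight_pos m n).le]
    exact inv_bergmanWeight_le m n

theorem weightOperator_mul_inv (m : ℕ) : weightOperator m * invWeightOperator m = 1 := by
  ext x n
  have : (bergmanWeight m n : ℂ) ≠ 0 := Complex.ofReal_ne_zero.mpr (bergmanWeight_pos m n).ne'
  simp [weightOperator, invWeightOperator, this]

theorem invWeightOperator_mul (m : ℕ) : invWeightOperator m * weightOperator m = 1 := by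
  ext x n
  have : (bergmanWeight m n : ℂ) ≠ 0 := Complex.ofReal_ne_zero.mpr (bergmanWeight_pos m n).ne'
  simp [weightOperator, invWeightOperator, this]

theorem isAsymptoticallySmall_diagonalOperator_sub_one {d : ℕ → ℂ} {K : ℝ} (hd : ∀ n, ‖d n‖ ≤ K)
    (h1 : Tendsto d atTop (𝓝 1)) : IsAsymptoticallySmall (diagonalOperator d hd - 1) := by
  have hb : ∀ n, ‖d n - 1‖ ≤ K + 1 := fun n =>
    (norm_sub_le _ _).trans (by simpa using hd n)
  have he : diagonalOperator d hd - 1 = diagonalOperator (fun n => d n - 1) hb := by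
    ext x n
    simp [sub_mul]
  rw [he]
  refine isAsymptoticallySmall_diagonalOperator _ ?_
  simpa using h1.sub_const 1

theorem tendsto_ofReal_bergmanWeight (m : ℕ) :
    Tendsto (fun n => (bergmanWeight m n : ℂ)) atTop (𝓝 1) := by
  rw [← Complex.ofReal_one]
  exact (Complex.continuous_ofReal.tendsto 1).comp (tendsto_bergmanWeight m)

theorem isAsymptoticallySmall_weightOperator_sub_one (m : ℕ) :
    IsAsymptoticallySmall (weightOperator m - 1) :=
  isAsymptoticallySmall_diagonalOperator_sub_one _ (tendsto_ofReal_bergmanWeight m)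

theorem isAsymptoticallySmall_invWeightOperator_sub_one (m : ℕ) :
    IsAsymptoticallySmall (invWeightOperator m - 1) :=
  isAsymptoticallySmall_diagonalOperator_sub_one _
    (by simpa using (tendsto_ofReal_bergmanWeight m).inv₀ one_ne_zero)

/-- The matrix of multiplication by `z ^ m` on the Bergman space. -/
noncomputable def bergmanShift (m : ℕ) : SqSummable →L[ℂ] SqSummable :=
  forwardShift m * weightOperator m

/-- The matrix of the Toeplitz operator with symbol `z̄ ^ m + α z ^ m + c`. -/
noncomputable def bergmanMatrix (m : ℕ) (α c : ℂ) : SqSummable →L[ℂ] SqSummable :=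
  (bergmanShift m).adjoint + α • bergmanShift m + c • 1

theorem adjoint_bergmanShift (m : ℕ) :
    (bergmanShift m).adjoint = weightOperator m * (forwardShift m).adjoint := by
  rw [bergmanShift]
  change ContinuousLinearMap.adjoint (_ ∘L _) = _
  rw [ContinuousLinearMap.adjoint_comp, weightOperator, adjoint_diagonalOperator_ofReal]
  rfl

/-- The lower triangular factor of `bergmanMatrix`. -/
noncomputable def lowerFactor (m : ℕ) (α c : ℂ) : SqSummable →L[ℂ] SqSummable :=
  1 + forwardShift m * invWeightOperator m * (α • bergmanShift m + c • 1)

/-- `F J⁻¹` is a right inverse of `S† = J F†`, so `S†` can be factored out of `α S + c` on the left.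
-/
theorem bergmanMatrix_eq (m : ℕ) (α c : ℂ) :
    bergmanMatrix m α c =
      weightOperator m * (forwardShift m).adjoint * lowerFactor m α c := by
  have h : weightOperator m * (forwardShift m).adjoint *
      (forwardShift m * invWeightOperator m * (α • bergmanShift m + c • 1)) =
      α • bergmanShift m + c • 1 := by
    calc _ = weightOperator m * ((forwardShift m).adjoint * forwardShift m) *
          invWeightOperator m * (α • bergmanShift m + c • 1) := by noncomm_ring
      _ = _ := by rw [adjoint_forwardShift_mul, mul_one, weightOperator_mul_inv, one_mul]
  rw [bergmanMatrix, lowerFactor, mul_add, h, mul_one, adjoint_bergmanShift, add_assoc]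

/-- For `J = J' = 1` this is the factorization of a quadratic polynomial in `F`. The last summand
collects the error; each of its terms contains `J - 1` or `J' - 1`, which are asymptotically small
in the application. -/
theorem one_add_mul_smul_eq {R : Type*} [Ring R] [Algebra ℂ R] (F J J' : R) (μ ν : ℂ) :
    1 + F * J' * ((μ * ν) • (F * J) + (-(μ + ν)) • 1) = (1 - μ • F) * (1 - ν • F) +
      F * ((μ * ν) • ((J' - 1) * F * J + F * (J - 1)) + (-(μ + ν)) • (J' - 1)) := by
  simp only [mul_add, mul_sub, sub_mul, mul_smul_comm, smul_mul_assoc, mul_one, one_mul,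
    ← mul_assoc]
  module

/-- Neumann series invert `1 - μ F` and `1 - ν F`, as `‖F‖ ≤ 1`. These inverses are lower
triangular, so multiplying the error `K` by them keeps it strictly lower triangular and
asymptotically small, and `isUnit_one_add` applies. -/
theorem isUnit_lowerFactor {m : ℕ} (hm : 1 ≤ m) {μ ν : ℂ} (hμ : ‖μ‖ < 1) (hν : ‖ν‖ < 1) :
    IsUnit (lowerFactor m (μ * ν) (-(μ + ν))) := by
  set F := forwardShift m with hF
  set J := weightOperator m with hJ
  set J' := invWeightOperator m with hJ'
  have hFl : IsLowerTriangular 1 F := (isLowerTriangular_forwardShift m).mono hm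
  have hJl : IsLowerTriangular 0 J := isLowerTriangular_diagonalOperator _ _
  have hJ'l : IsLowerTriangular 0 J' := isLowerTriangular_diagonalOperator _ _
  have hunit : ∀ a : ℂ, ‖a‖ < 1 → IsUnit (1 - a • F) := fun a ha => by
    refine isUnit_one_sub_of_norm_lt_one ?_
    calc ‖a • F‖ = ‖a‖ * ‖F‖ := norm_smul a F
      _ ≤ ‖a‖ * 1 := by gcongr; exact norm_forwardShift_le m
      _ < 1 := by rwa [mul_one]
  obtain ⟨u, hu⟩ := hunit μ hμ
  obtain ⟨v, hv⟩ := hunit ν hν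
  have hul : IsLowerTriangular 0 (↑u⁻¹ : SqSummable →L[ℂ] SqSummable) :=
    (hFl.smul μ).of_one_sub_mul_eq_one (by rw [← hu, Units.mul_inv])
  have hvl : IsLowerTriangular 0 (↑v⁻¹ : SqSummable →L[ℂ] SqSummable) :=
    (hFl.smul ν).of_one_sub_mul_eq_one (by rw [← hv, Units.mul_inv])
  set K : SqSummable →L[ℂ] SqSummable :=
    F * ((μ * ν) • ((J' - 1) * F * J + F * (J - 1)) + (-(μ + ν)) • (J' - 1)) with hK
  have hKs : IsAsymptoticallySmall K := by
    have h1 := isAsymptoticallySmall_weightOperator_sub_one m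
    have h2 := isAsymptoticallySmall_invWeightOperator_sub_one m
    exact (((((h2.mul_right (hFl.mono zero_le_one)).mul_right hJl).add
      (h1.mul_left F)).smul _).add (h2.smul _)).mul_left F
  have hKl : IsLowerTriangular 1 K := by
    have h0 : IsLowerTriangular 0 F := hFl.mono zero_le_one
    have h1 : IsLowerTriangular 0 (J - 1) := hJl.sub .one
    have h2 : IsLowerTriangular 0 (J' - 1) := hJ'l.sub .one
    exact hFl.comp (((((h2.comp h0).comp hJl).add (h0.comp h1)).smul _).add (h2.smul _))
  have hL : lowerFactor m (μ * ν) (-(μ + ν)) = u * v + K := by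
    rw [hu, hv, hK, lowerFactor, bergmanShift, ← hF, ← hJ, ← hJ']
    exact one_add_mul_smul_eq F J J' μ ν
  have hN := (hKs.mul_left (↑v⁻¹ * ↑u⁻¹ : SqSummable →L[ℂ] SqSummable)).isUnit_one_add
    ((hvl.comp hul).comp hKl |>.mono (by omega))
  have : lowerFactor m (μ * ν) (-(μ + ν)) =
      u * v * (1 + ↑v⁻¹ * ↑u⁻¹ * K) := by
    rw [hL]
    calc (u * v + K : SqSummable →L[ℂ] SqSummable)
        = u * v + u * (v * ↑v⁻¹) * ↑u⁻¹ * K := by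
          rw [Units.mul_inv, mul_one, Units.mul_inv, one_mul]
      _ = _ := by noncomm_ring
  rw [this]
  exact (u.isUnit.mul v.isUnit).mul hN

/-- If both roots of `X² + c X + α` lie in the unit disk, the operator `S† + α S + c` has a right
inverse and a kernel of dimension `m`. -/
theorem exists_rightInverse_bergmanMatrix {m : ℕ} (hm : 1 ≤ m) {μ ν : ℂ} (hμ : ‖μ‖ < 1)
    (hν : ‖ν‖ < 1) :
    (∃ G, bergmanMatrix m (μ * ν) (-(μ + ν)) * G = 1) ∧
      Nonempty ((bergmanMatrix m (μ * ν) (-(μ + ν))).ker ≃ₗ[ℂ] (Fin m → ℂ)) := by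
  obtain ⟨u, hu⟩ := isUnit_lowerFactor hm hμ hν
  rw [bergmanMatrix_eq, ← hu]
  constructor
  · refine ⟨↑u⁻¹ * (forwardShift m * invWeightOperator m), ?_⟩
    calc _ = weightOperator m * ((forwardShift m).adjoint * ((u * ↑u⁻¹) * forwardShift m)) *
          invWeightOperator m := by noncomm_ring
      _ = 1 := by
        rw [Units.mul_inv, one_mul, adjoint_forwardShift_mul, mul_one, weightOperator_mul_inv]
  · let e : SqSummable ≃L[ℂ] SqSummable := ContinuousLinearEquiv.unitsEquiv ℂ SqSummable u
    -- The invertible `J` does not change the kernel, and `L` carries it onto that of `F†`.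
    have hker : (weightOperator m * (forwardShift m).adjoint * (u : SqSummable →L[ℂ] SqSummable)).ker
        = (forwardShift m).adjoint.ker.comap (e.toLinearEquiv : SqSummable →ₗ[ℂ] SqSummable) := by
      ext x
      change weightOperator m ((forwardShift m).adjoint ((u : SqSummable →L[ℂ] SqSummable) x)) = 0 ↔
        (forwardShift m).adjoint ((u : SqSummable →L[ℂ] SqSummable) x) = 0
      refine ⟨fun h => ?_, fun h => by rw [h, map_zero]⟩
      have h2 := congrArg (invWeightOperator m) h
      rw [map_zero, ← mul_apply_eq_comp, invWeightOperator_mul] at h2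
      exact h2
    rw [hker]
    exact ⟨(e.toLinearEquiv.ofSubmodule' _).trans (kerBackwardShiftEquiv m)⟩

/-! ### The symbol -/

/-- The symbol depends only on `z ^ m`, and `z ↦ z ^ m` maps the disk onto itself. -/
theorem image_harmonicSymbol_ball {m : ℕ} (hm : 1 ≤ m) (α β : ℂ) :
    harmonicSymbol m α β '' ball 0 1 = (fun u => conj u + α * u + β) '' ball 0 1 := by
  ext w
  constructor
  · rintro ⟨z, hz, rfl⟩
    refine ⟨z ^ m, ?_, by simp [harmonicSymbol]⟩
    rw [mem_ball_zero_iff] at hz ⊢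
    rw [norm_pow]
    exact pow_lt_one₀ (norm_nonneg _) hz (by omega)
  · rintro ⟨u, hu, rfl⟩
    obtain ⟨z, rfl⟩ := IsAlgClosed.exists_pow_nat_eq u (by omega : 0 < m)
    refine ⟨z, ?_, by simp [harmonicSymbol]⟩
    rw [mem_ball_zero_iff] at hu ⊢
    rw [norm_pow] at hu
    exact (pow_lt_one_iff_of_nonneg (norm_nonneg _) (by omega)).mp hu

/-- After the rotation `u = conj ζ * v`, with `ζ` of half the argument of `α`, the map `u ↦ conj u +
α u` becomes `ζ` times `v ↦ conj v + |α| v`, which scales the real part by `|α| + 1` and the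
imaginary part by `|α| - 1`. -/
theorem exists_image_eq_ellipse {α : ℂ} (hα : ‖α‖ ≠ 1) (β : ℂ) :
    ∃ ζ : ℂ, ‖ζ‖ = 1 ∧ α = ‖α‖ * ζ ^ 2 ∧
      (fun u => conj u + α * u + β) '' ball 0 1 =
        {w : ℂ | ∃ x y : ℝ, w = β + ζ * (x + y * Complex.I) ∧
          x ^ 2 / (‖α‖ + 1) ^ 2 + y ^ 2 / (‖α‖ - 1) ^ 2 < 1} := by
  have hζ : ‖Complex.exp ((α.arg / 2 : ℝ) * Complex.I)‖ = 1 := Complex.norm_exp_ofReal_mul_I _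
  have hα2 : α = ‖α‖ * Complex.exp ((α.arg / 2 : ℝ) * Complex.I) ^ 2 := by
    rw [← Complex.exp_nat_mul]
    nth_rw 1 [← Complex.norm_mul_exp_arg_mul_I α]
    congr 2
    push_cast
    ring
  generalize Complex.exp ((α.arg / 2 : ℝ) * Complex.I) = ζ at hζ hα2
  refine ⟨ζ, hζ, hα2, ?_⟩
  have hcc : ζ * conj ζ = 1 := by rw [Complex.mul_conj, Complex.normSq_eq_norm_sq, hζ]; simp
  have h1 : ‖α‖ + 1 ≠ 0 := by positivity
  have h2 : ‖α‖ - 1 ≠ 0 := sub_ne_zero.mpr hα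
  have hkey : ∀ v : ℂ, conj (conj ζ * v) + α * (conj ζ * v) + β =
      β + ζ * (((‖α‖ + 1) * v.re : ℝ) + ((‖α‖ - 1) * v.im : ℝ) * Complex.I) := by
    intro v
    have : α * (conj ζ * v) = ‖α‖ * ζ * v := by
      nth_rw 1 [hα2]
      linear_combination (‖α‖ * ζ * v : ℂ) * hcc
    rw [this, map_mul, Complex.conj_conj]
    nth_rw 2 [← Complex.re_add_im v]
    nth_rw 1 [← Complex.re_add_im v]
    simp only [map_add, map_mul, Complex.conj_ofReal, Complex.conj_I]
    push_cast
    ring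
  have hn : ∀ v : ℂ, ‖v‖ < 1 ↔ v.re ^ 2 + v.im ^ 2 < 1 := by
    intro v
    rw [← sq_lt_one_iff₀ (norm_nonneg _), ← Complex.normSq_eq_norm_sq, Complex.normSq_apply]
    ring_nf
  ext w
  constructor
  · rintro ⟨u, hu, rfl⟩
    have hv : u = conj ζ * (ζ * u) := by linear_combination (-u) * hcc
    refine ⟨(‖α‖ + 1) * (ζ * u).re, (‖α‖ - 1) * (ζ * u).im, ?_, ?_⟩
    · rw [← hkey, ← hv]
    · rw [mul_pow, mul_pow, mul_div_cancel_left₀ _ (pow_ne_zero 2 h1),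
        mul_div_cancel_left₀ _ (pow_ne_zero 2 h2), ← hn, norm_mul, hζ, one_mul]
      exact mem_ball_zero_iff.mp hu
  · rintro ⟨x, y, rfl, hxy⟩
    refine ⟨conj ζ * (⟨x / (‖α‖ + 1), y / (‖α‖ - 1)⟩ : ℂ), ?_, ?_⟩
    · rw [mem_ball_zero_iff, norm_mul, RCLike.norm_conj, hζ, one_mul, hn]
      simpa only [div_pow] using hxy
    · change conj _ + α * _ + β = _
      rw [hkey]
      simp only [mul_div_cancel₀ _ h1, mul_div_cancel₀ _ h2]

/-- The map `u ↦ conj u + α u` is injective: a difference `d` of two points with equal values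
satisfies `conj d = -α d`, so `|d| = |α| |d|` and `d = 0`. -/
theorem notMem_image_sphere {m : ℕ} {α β u : ℂ} (hα : ‖α‖ ≠ 1) (hu : ‖u‖ < 1) :
    conj u + α * u + β ∉ harmonicSymbol m α β '' sphere 0 1 := by
  rintro ⟨z, hz, h⟩
  have hv : ‖z ^ m‖ = 1 := by rw [norm_pow, mem_sphere_zero_iff_norm.mp hz, one_pow]
  rw [harmonicSymbol, ← map_pow] at h
  have h1 : conj (z ^ m - u) = α * (u - z ^ m) := by
    rw [map_sub]
    linear_combination h
  have h2 : ‖z ^ m - u‖ = ‖α‖ * ‖z ^ m - u‖ := by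
    calc ‖z ^ m - u‖ = ‖conj (z ^ m - u)‖ := (RCLike.norm_conj _).symm
      _ = ‖α‖ * ‖z ^ m - u‖ := by rw [h1, norm_mul, norm_sub_rev]
  have h3 : ‖z ^ m - u‖ = 0 := by
    by_contra h0
    exact hα (mul_right_cancel₀ h0 (by rw [← h2, one_mul]))
  rw [sub_eq_zero.mp (norm_eq_zero.mp h3)] at hv
  linarith

/-- The roots of `X² - (ū + α u) X + α` lie in the unit disk if `α` and `u` do. -/
theorem exists_roots_of_norm_lt_one {α u : ℂ} (hα : ‖α‖ < 1) (hu : ‖u‖ < 1) :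
    ∃ μ ν : ℂ, ‖μ‖ < 1 ∧ ‖ν‖ < 1 ∧ μ * ν = α ∧ μ + ν = conj u + α * u := by
  obtain ⟨s, hs⟩ := IsAlgClosed.exists_pow_nat_eq ((conj u + α * u) ^ 2 - 4 * α) two_pos
  have key : ∀ μ ν : ℂ, μ * ν = α → μ + ν = conj u + α * u → ‖μ‖ < 1 := by
    intro μ ν hp hsum
    by_contra! hμ
    have hν : ‖ν‖ < 1 := by
      have : ‖μ‖ * ‖ν‖ < 1 := by rwa [← norm_mul, hp]
      nlinarith [norm_nonneg ν]
    -- If `|μ| ≥ 1`, the Blaschke-type identity `h3` gives `|μ - conj u| ≥ |1 - μ u|`, while `|ν| <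
    -- 1` gives the strict opposite unless both sides vanish. Then `μ = conj u`, contrary to `|u| <
    -- 1`.
    have h1 : μ - conj u = -(ν * (1 - μ * u)) := by
      rw [← hp] at hsum
      linear_combination hsum
    have h2 : ‖μ - conj u‖ = ‖ν‖ * ‖1 - μ * u‖ := by rw [h1, norm_neg, norm_mul]
    have h3 : ‖μ - conj u‖ ^ 2 - ‖1 - μ * u‖ ^ 2 = (‖μ‖ ^ 2 - 1) * (1 - ‖u‖ ^ 2) := by
      simp only [← Complex.normSq_eq_norm_sq, Complex.normSq_apply, Complex.sub_re, Complex.sub_im,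
        Complex.conj_re, Complex.conj_im, Complex.mul_re, Complex.mul_im, Complex.one_re,
        Complex.one_im]
      ring
    have h4 : 0 ≤ (‖μ‖ ^ 2 - 1) * (1 - ‖u‖ ^ 2) :=
      mul_nonneg (by nlinarith) (by nlinarith [norm_nonneg u])
    have h5 : ‖1 - μ * u‖ = 0 := by
      by_contra h0
      have h6 : 0 < ‖1 - μ * u‖ := lt_of_le_of_ne (norm_nonneg _) (Ne.symm h0)
      have h7 : ‖ν‖ ^ 2 < 1 := by nlinarith [norm_nonneg ν]
      rw [h2, mul_pow] at h3
      nlinarith [sq_pos_of_pos h6]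
    rw [h5, mul_zero] at h2
    have h8 : μ = conj u := sub_eq_zero.mp (norm_eq_zero.mp h2)
    rw [h8, RCLike.norm_conj] at hμ
    linarith
  set a := conj u + α * u
  have hp : (a + s) / 2 * ((a - s) / 2) = α := by linear_combination (-1 / 4) * hs
  exact ⟨(a + s) / 2, (a - s) / 2, key _ _ hp (by ring),
    key ((a - s) / 2) ((a + s) / 2) (by rw [mul_comm, hp]) (by ring), hp, by ring⟩

/-! ### The winding number -/

theorem harmonicSymbol_circleMap (m : ℕ) (α β : ℂ) (θ : ℝ) :
    harmonicSymbol m α β (circleMap 0 1 θ) =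
      (circleMap 0 1 θ ^ m)⁻¹ + α * circleMap 0 1 θ ^ m + β := by
  have h : conj (circleMap 0 1 θ) = (circleMap 0 1 θ)⁻¹ := by
    rw [Complex.inv_def, Complex.normSq_eq_norm_sq]
    simp
  rw [harmonicSymbol, h, inv_pow]

theorem deriv_harmonicSymbol_circleMap (m : ℕ) (α β : ℂ) (θ : ℝ) :
    deriv (fun t : ℝ => harmonicSymbol m α β (circleMap 0 1 t)) θ =
      m * Complex.I * (α * circleMap 0 1 θ ^ m - (circleMap 0 1 θ ^ m)⁻¹) := by
  simp only [harmonicSymbol_circleMap]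
  have hne : circleMap 0 1 θ ≠ 0 := circleMap_ne_center one_ne_zero
  have h0 : circleMap 0 1 θ ^ m ≠ 0 := pow_ne_zero _ hne
  have h1 : HasDerivAt (fun t => circleMap 0 1 t ^ m)
      (m * Complex.I * circleMap 0 1 θ ^ m) θ := by
    refine ((hasDerivAt_circleMap 0 1 θ).fun_pow m).congr_deriv ?_
    rcases m with _ | m
    · simp
    · rw [Nat.add_sub_cancel, pow_succ, circleMap_zero]
      ring
  have h2 := ((h1.fun_inv h0).fun_add (h1.const_mul α)).add_const β
  rw [HasDerivAt.deriv h2]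
  field_simp
  ring

theorem windingNumber_harmonicSymbol (m : ℕ) (α β w : ℂ) :
    windingNumber (harmonicSymbol m α β) w = (2 * Real.pi * Complex.I)⁻¹ *
      ∫ θ in (0 : ℝ)..(2 * Real.pi),
        m * Complex.I * (α * circleMap 0 1 θ ^ m - (circleMap 0 1 θ ^ m)⁻¹) /
          ((circleMap 0 1 θ ^ m)⁻¹ + α * circleMap 0 1 θ ^ m + (β - w)) := by
  simp only [windingNumber, deriv_harmonicSymbol_circleMap]
  simp only [harmonicSymbol_circleMap, add_sub_assoc]

/-- Cancelling `q⁻¹`, where `q = z ^ m`, turns the integrand into `-(m i) g(z)` with `g` analytic on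
the closed disk and `g 0 = 1`; the mean value property evaluates the integral. -/
theorem integral_logDeriv_symbol {m : ℕ} (hm : 1 ≤ m) {μ ν : ℂ} (hμ : ‖μ‖ < 1) (hν : ‖ν‖ < 1) :
    ∫ θ in (0 : ℝ)..(2 * Real.pi),
        m * Complex.I * (μ * ν * circleMap 0 1 θ ^ m - (circleMap 0 1 θ ^ m)⁻¹) /
          ((circleMap 0 1 θ ^ m)⁻¹ + μ * ν * circleMap 0 1 θ ^ m + -(μ + ν)) =
      -(m * (2 * Real.pi * Complex.I)) := by
  have hne : ∀ a : ℂ, ‖a‖ < 1 → ∀ z ∈ closedBall (0 : ℂ) 1, 1 - a * z ^ m ≠ 0 := by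
    intro a ha z hz h
    have h1 : ‖a * z ^ m‖ = 1 := by rw [← sub_eq_zero.mp h, norm_one]
    rw [norm_mul, norm_pow] at h1
    have h2 : ‖z‖ ^ m ≤ 1 := pow_le_one₀ (norm_nonneg _) (mem_closedBall_zero_iff.mp hz)
    nlinarith [norm_nonneg a]
  set g : ℂ → ℂ := fun z => (1 - μ * ν * z ^ m * z ^ m) / ((1 - μ * z ^ m) * (1 - ν * z ^ m)) with hg
  have hd : DifferentiableOn ℂ g (closedBall 0 1) := by
    intro z hz
    refine DifferentiableWithinAt.div (by fun_prop) (by fun_prop) ?_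
    exact mul_ne_zero (hne μ hμ z hz) (hne ν hν z hz)
  have hav : Real.circleAverage g 0 1 = 1 := by
    have h : DiffContOnCl ℂ g (ball 0 |1|) := by
      refine DifferentiableOn.diffContOnCl (hd.mono ?_)
      rw [abs_one]
      exact closure_ball_subset_closedBall
    rw [h.circleAverage, hg]
    simp [show m ≠ 0 by omega]
  rw [Real.circleAverage, inv_smul_eq_iff₀ (by positivity)] at hav
  have hcongr : ∀ θ : ℝ,
      m * Complex.I * (μ * ν * circleMap 0 1 θ ^ m - (circleMap 0 1 θ ^ m)⁻¹) /
          ((circleMap 0 1 θ ^ m)⁻¹ + μ * ν * circleMap 0 1 θ ^ m + -(μ + ν)) =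
      -(m * Complex.I) * g (circleMap 0 1 θ) := by
    intro θ
    have hz : circleMap 0 1 θ ∈ closedBall (0 : ℂ) 1 := by simp
    have h0 : circleMap 0 1 θ ^ m ≠ 0 := pow_ne_zero _ (circleMap_ne_center one_ne_zero)
    have h1 := hne μ hμ _ hz
    have h2 := hne ν hν _ hz
    simp only [hg]
    generalize circleMap 0 1 θ ^ m = q at *
    have h3 : q⁻¹ + μ * ν * q + -(μ + ν) = q⁻¹ * ((1 - μ * q) * (1 - ν * q)) := by
      field_simp
      ring
    rw [h3]
    field_simp
    ring
  simp only [hcongr]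
  rw [intervalIntegral.integral_const_mul, hav]
  simp
  ring

theorem windingNumber_of_norm_lt_one {m : ℕ} (hm : 1 ≤ m) {α β u : ℂ} (hα : ‖α‖ < 1)
    (hu : ‖u‖ < 1) : windingNumber (harmonicSymbol m α β) (conj u + α * u + β) = -m := by
  obtain ⟨μ, ν, hμ, hν, rfl, hs⟩ := exists_roots_of_norm_lt_one hα hu
  rw [windingNumber_harmonicSymbol, ← hs, sub_add_cancel_right,
    integral_logDeriv_symbol hm hμ hν]
  have : (2 * Real.pi * Complex.I : ℂ) ≠ 0 := Complex.two_pi_I_ne_zero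
  field_simp

/-- On the circle `φ - w` is `α` times the conjugate of the corresponding expression for `1 / conj
α` and the same `u`. Conjugation reverses the sign of the winding number. -/
theorem windingNumber_of_one_lt_norm {m : ℕ} (hm : 1 ≤ m) {α β u : ℂ} (hα : 1 < ‖α‖)
    (hu : ‖u‖ < 1) : windingNumber (harmonicSymbol m α β) (conj u + α * u + β) = m := by
  have hα0 : conj α ≠ 0 := by
    rw [map_ne_zero, ← norm_pos_iff]
    linarith
  have hα' : ‖(conj α)⁻¹‖ < 1 := by
    rw [norm_inv, RCLike.norm_conj]
    exact inv_lt_one_of_one_lt₀ hα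
  obtain ⟨μ, ν, hμ, hν, hp, hs⟩ := exists_roots_of_norm_lt_one hα' hu
  have hcongr : ∀ θ : ℝ,
      m * Complex.I * (α * circleMap 0 1 θ ^ m - (circleMap 0 1 θ ^ m)⁻¹) /
          ((circleMap 0 1 θ ^ m)⁻¹ + α * circleMap 0 1 θ ^ m + -(conj u + α * u)) =
      conj (m * Complex.I * (μ * ν * circleMap 0 1 θ ^ m - (circleMap 0 1 θ ^ m)⁻¹) /
          ((circleMap 0 1 θ ^ m)⁻¹ + μ * ν * circleMap 0 1 θ ^ m + -(μ + ν))) := by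
    intro θ
    have h0 : circleMap 0 1 θ ^ m ≠ 0 := pow_ne_zero _ (circleMap_ne_center one_ne_zero)
    have hc : conj (circleMap 0 1 θ ^ m) = (circleMap 0 1 θ ^ m)⁻¹ := by
      rw [Complex.inv_def, Complex.normSq_eq_norm_sq]
      simp
    have hα1 : α ≠ 0 := by simpa using hα0
    rw [hp, hs]
    simp only [map_div₀, map_mul, map_add, map_sub, map_neg, map_inv₀, hc, Complex.conj_conj,
      Complex.conj_I, Complex.conj_natCast, inv_inv]
    generalize circleMap 0 1 θ ^ m = q at *
    rw [← mul_div_mul_left _ (q + α⁻¹ * q⁻¹ + -(u + α⁻¹ * conj u)) hα1]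
    congr 1
    · field_simp
      ring
    · field_simp
      ring
  rw [windingNumber_harmonicSymbol, sub_add_cancel_right]
  simp only [hcongr]
  rw [intervalIntegral.intervalIntegral_conj, integral_logDeriv_symbol hm hμ hν]
  have : (2 * Real.pi * Complex.I : ℂ) ≠ 0 := Complex.two_pi_I_ne_zero
  simp only [map_neg, map_mul, Complex.conj_natCast, Complex.conj_ofReal, Complex.conj_I,
    map_ofNat]
  field_simp

/-! ### Fredholm index of right invertible operators and their adjoints -/

theorem surjective_of_mul_eq_one {H : Type*} [NormedAddCommGroup H] [NormedSpace ℂ H]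
    {T G : H →L[ℂ] H} (h : T * G = 1) : Function.Surjective T := fun y =>
  ⟨G y, congrArg (fun A : H →L[ℂ] H => A y) h⟩

theorem fredholmIndex_of_mul_eq_one {H : Type*} [NormedAddCommGroup H] [NormedSpace ℂ H]
    {T G : H →L[ℂ] H} (h : T * G = 1) :
    fredholmIndex T = Module.finrank ℂ T.ker := by
  have hr : T.range = ⊤ := LinearMap.range_eq_top.mpr (surjective_of_mul_eq_one h)
  have h0 : Module.finrank ℂ (H ⧸ (⊤ : Submodule ℂ H)) = 0 :=
    Module.finrank_zero_of_subsingleton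
  rw [fredholmIndex, hr, h0, Nat.cast_zero, sub_zero]

section RightInverse

variable {H : Type*} [NormedAddCommGroup H] [InnerProductSpace ℂ H] [CompleteSpace H]
  {T G : H →L[ℂ] H}

theorem isFredholm_of_mul_eq_one (h : T * G = 1) [FiniteDimensional ℂ T.ker] : T.IsFredholm := by
  have hs := surjective_of_mul_eq_one h
  have hr : T.range = ⊤ := LinearMap.range_eq_top.mpr hs
  refine ⟨(T.isOpenMap hs).isStrictMap T.continuous, ?_, inferInstance, ?_,
    Submodule.ClosedComplemented.of_finiteDimensional _⟩
  · rw [hr]; exact isClosed_univ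
  · rw [hr]; exact Submodule.CoFG.top

theorem adjoint_mul_adjoint_of_mul_eq_one (h : T * G = 1) : G.adjoint * T.adjoint = 1 := by
  have := congrArg star h
  rwa [star_mul, star_one] at this

theorem range_adjoint_of_mul_eq_one (h : T * G = 1) : T.adjoint.range = T.kerᗮ := by
  ext y
  constructor
  · rintro ⟨x, rfl⟩ z hz
    change inner ℂ z (T.adjoint x) = 0
    rw [ContinuousLinearMap.adjoint_inner_right, show T z = 0 from hz, inner_zero_left]
  · intro hy
    -- `G.adjoint y` is a preimage because `G (T z) - z` always lies in the kernel of `T`, to which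
    -- `y` is orthogonal.
    refine ⟨G.adjoint y, ?_⟩
    change T.adjoint (G.adjoint y) = y
    refine ext_inner_left ℂ fun z => ?_
    rw [ContinuousLinearMap.adjoint_inner_right, ContinuousLinearMap.adjoint_inner_right,
      ← sub_eq_zero, ← inner_sub_left]
    refine hy _ ?_
    change T (G (T z) - z) = 0
    rw [map_sub, ← mul_apply_eq_comp, h, one_apply_eq_self, sub_self]

theorem ker_adjoint_of_mul_eq_one (h : T * G = 1) : T.adjoint.ker = ⊥ := by
  rw [LinearMap.ker_eq_bot]
  refine Function.LeftInverse.injective (g := G.adjoint) fun x => ?_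
  exact congrArg (fun A : H →L[ℂ] H => A x) (adjoint_mul_adjoint_of_mul_eq_one h)

/-- The cokernel of the adjoint of a right invertible operator is the kernel of the operator. -/
noncomputable def cokerAdjointEquiv (h : T * G = 1) : (H ⧸ T.adjoint.range) ≃ₗ[ℂ] T.ker :=
  (Submodule.quotEquivOfEq _ _ (range_adjoint_of_mul_eq_one h)).trans
    (Submodule.quotientEquivOfIsCompl _ _
      (Submodule.isCompl_orthogonal T.ker).symm)

theorem isFredholm_adjoint_of_mul_eq_one (h : T * G = 1) [FiniteDimensional ℂ T.ker] :
    T.adjoint.IsFredholm := by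
  have he : Topology.IsClosedEmbedding T.adjoint := by
    have hl : Function.LeftInverse G.adjoint T.adjoint := fun x =>
      congrArg (fun A : H →L[ℂ] H => A x) (adjoint_mul_adjoint_of_mul_eq_one h)
    exact hl.isClosedEmbedding G.adjoint.continuous T.adjoint.continuous
  refine ⟨he.isClosedMap.isStrictMap he.continuous, he.isClosed_range, ?_, ?_, ?_⟩
  · rw [ker_adjoint_of_mul_eq_one h]; infer_instance
  · exact Module.Finite.equiv (cokerAdjointEquiv h).symm
  · rw [ker_adjoint_of_mul_eq_one h]
    exact Submodule.ClosedComplemented.of_finiteDimensional _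

theorem fredholmIndex_adjoint_of_mul_eq_one (h : T * G = 1) :
    fredholmIndex T.adjoint = -Module.finrank ℂ T.ker := by
  rw [fredholmIndex, ker_adjoint_of_mul_eq_one h, finrank_bot, (cokerAdjointEquiv h).finrank_eq]
  simp

end RightInverse

/-- Trades `|α| > 1` for `|α| < 1`: the adjoint exchanges `S` and `S†`, and the factor `conj α`
restores the coefficient `1` of `S†`. -/
theorem bergmanMatrix_eq_adjoint (m : ℕ) {α : ℂ} (hα : α ≠ 0) (c : ℂ) :
    bergmanMatrix m α c = star (conj α • bergmanMatrix m (conj α)⁻¹ (conj c / conj α)) := by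
  have hα' : conj α ≠ 0 := by simpa using hα
  rw [bergmanMatrix, bergmanMatrix, ← ContinuousLinearMap.star_eq_adjoint]
  simp only [star_smul, star_add, star_star, star_one, smul_add, smul_smul]
  rw [mul_inv_cancel₀ hα', mul_div_cancel₀ _ hα', star_one, one_smul, ← starRingEnd_apply,
    ← starRingEnd_apply, Complex.conj_conj, Complex.conj_conj]
  abel

/-! ### The monomial basis of the Bergman space -/

theorem integral_ball_eq_polar {f : ℂ → ℂ} (hc : ContinuousOn f (ball 0 1))
    (hi : IntegrableOn f (ball 0 1)) :
    ∫ z in ball 0 1, f z =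
      ∫ r in Set.Ioo (0 : ℝ) 1, r • ∫ θ in (0 : ℝ)..(2 * Real.pi), f (circleMap 0 r θ) := by
  classical
  set F : ℂ → ℂ := (ball (0 : ℂ) 1).indicator f with hF
  have hFm : Measurable F := by
    rw [hF, ← Set.piecewise_eq_indicator]
    exact hc.measurable_piecewise continuousOn_const isOpen_ball.measurableSet
  have hsymm : Measurable fun p : ℝ × ℝ => Complex.polarCoord.symm p := by
    simp only [Complex.polarCoord_symm_apply]
    fun_prop
  have hFi : Integrable F := (integrable_indicator_iff isOpen_ball.measurableSet).mpr hi
  have hpi : IntegrableOn (fun p : ℝ × ℝ => p.1 • F (Complex.polarCoord.symm p))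
      (Set.Ioi (0 : ℝ) ×ˢ Set.Ioo (-Real.pi) Real.pi) (volume.prod volume) := by
    refine ⟨(measurable_fst.smul (hFm.comp hsymm)).aestronglyMeasurable, ?_⟩
    have h1 := Complex.lintegral_comp_polarCoord_symm fun z => ‖F z‖ₑ
    rw [polarCoord_target] at h1
    rw [HasFiniteIntegral, ← Measure.volume_eq_prod]
    have h2 : ∫⁻ p in Set.Ioi (0 : ℝ) ×ˢ Set.Ioo (-Real.pi) Real.pi,
        ‖p.1 • F (Complex.polarCoord.symm p)‖ₑ = ∫⁻ z, ‖F z‖ₑ := by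
      rw [← h1]
      refine setLIntegral_congr_fun (measurableSet_Ioi.prod measurableSet_Ioo) fun p hp => ?_
      simp only [enorm_smul, smul_eq_mul]
      rw [Real.enorm_eq_ofReal (le_of_lt hp.1)]
    rw [h2]
    exact hFi.2
  rw [← integral_indicator isOpen_ball.measurableSet, ← Complex.integral_comp_polarCoord_symm,
    polarCoord_target, Measure.volume_eq_prod, setIntegral_prod _ hpi]
  have hinner : ∀ r : ℝ, 0 < r → ∫ θ in Set.Ioo (-Real.pi) Real.pi,
      r • F (Complex.polarCoord.symm (r, θ)) =
        r • ∫ θ in (0 : ℝ)..(2 * Real.pi), F (circleMap 0 r θ) := by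
    intro r _
    -- Polar coordinates use angles in `(-π, π)`, circle integrals use `[0, 2π]`; periodicity
    -- reconciles them.
    have hp : Function.Periodic (fun θ => F (circleMap 0 r θ)) (2 * Real.pi) := fun θ => by
      simp only [periodic_circleMap 0 r θ]
    have h2 := hp.intervalIntegral_add_eq 0 (-Real.pi)
    rw [zero_add, show -Real.pi + 2 * Real.pi = Real.pi by ring] at h2
    rw [integral_smul, h2, intervalIntegral.integral_of_le (by linarith [Real.pi_pos]),
      integral_Ioc_eq_integral_Ioo]
    congr 2
    ext θ
    congr 1
    simp [circleMap, Complex.exp_mul_I]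
  have hmem : ∀ r : ℝ, 0 < r → ∀ θ, circleMap 0 r θ ∈ ball (0 : ℂ) 1 ↔ r < 1 := by
    intro r hr θ
    rw [mem_ball_zero_iff, norm_circleMap_zero, abs_of_pos hr]
  have hsub : Set.Ioo (0 : ℝ) 1 ⊆ Set.Ioi 0 := fun r hr => hr.1
  rw [setIntegral_congr_fun measurableSet_Ioi hinner]
  refine (setIntegral_eq_of_subset_of_forall_sdiff_eq_zero measurableSet_Ioi hsub ?_).trans
    (setIntegral_congr_fun measurableSet_Ioo fun r hr => ?_)
  · intro r hr
    have h0 : ∀ θ, F (circleMap 0 r θ) = 0 := fun θ =>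
      Set.indicator_of_notMem (fun h => hr.2 ⟨hr.1, (hmem r hr.1 θ).mp h⟩) _
    simp only [h0, intervalIntegral.integral_zero, smul_zero]
  · congr 2
    ext θ
    rw [hF, Set.indicator_of_mem ((hmem r hr.1 θ).mpr hr.2)]

instance : IsFiniteMeasure diskMeasure := by
  constructor
  rw [diskMeasure, Measure.smul_apply, Measure.restrict_apply_univ, smul_eq_mul]
  refine ENNReal.mul_lt_top ?_ measure_ball_lt_top
  simp [Real.pi_pos]

theorem integral_diskMeasure (f : ℂ → ℂ) :
    ∫ z, f z ∂diskMeasure = (Real.pi : ℂ)⁻¹ * ∫ z in ball 0 1, f z := by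
  rw [diskMeasure, integral_smul_measure, ENNReal.toReal_inv,
    ENNReal.toReal_ofReal Real.pi_pos.le, Complex.real_smul, Complex.ofReal_inv]

theorem ae_diskMeasure_mem_ball : ∀ᵐ z ∂diskMeasure, z ∈ ball (0 : ℂ) 1 :=
  Measure.ae_smul_measure (ae_restrict_mem isOpen_ball.measurableSet) _

theorem integrableOn_of_integrable_diskMeasure {f : ℂ → ℂ} (hf : Integrable f diskMeasure) :
    IntegrableOn f (ball 0 1) := by
  rw [diskMeasure, integrable_smul_measure] at hf
  · exact hf
  · simp
  · simp [Real.pi_pos]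

theorem integrable_conj_pow_mul {g : ℂ → ℂ} (hg : Integrable g diskMeasure) (k : ℕ) :
    Integrable (fun z => conj z ^ k * g z) diskMeasure := by
  refine hg.bdd_mul (c := 1) (by fun_prop) ?_
  filter_upwards [ae_diskMeasure_mem_ball] with z hz
  rw [norm_pow, RCLike.norm_conj]
  exact pow_le_one₀ (norm_nonneg _) (mem_ball_zero_iff.mp hz).le

/-- On the circle of radius `r` one has `conj z = r² / z`, which turns the integral into Cauchy's
formula for the Taylor coefficient of order `k`. -/
theorem integral_circle_conj_pow_mul {g : ℂ → ℂ} (hg : DifferentiableOn ℂ g (ball 0 1)) (k : ℕ)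
    {r : ℝ} (h0 : 0 < r) (h1 : r < 1) :
    ∫ θ in (0 : ℝ)..(2 * Real.pi), conj (circleMap 0 r θ) ^ k * g (circleMap 0 r θ) =
      (r : ℂ) ^ (2 * k) * (2 * Real.pi * (iteratedDeriv k g 0 / k.factorial)) := by
  have h := (hg.mono (closedBall_subset_ball h1)).circleIntegral_one_div_sub_center_pow_smul h0 k
  rw [circleIntegral] at h
  have hcongr : ∀ θ : ℝ, conj (circleMap 0 r θ) ^ k * g (circleMap 0 r θ) =
      (r : ℂ) ^ (2 * k) * Complex.I⁻¹ * (deriv (circleMap 0 r) θ • (1 / (circleMap 0 r θ - 0) ^ (k + 1)) •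
        g (circleMap 0 r θ)) := by
    intro θ
    have hne : circleMap 0 r θ ≠ 0 := circleMap_ne_center h0.ne'
    have hc : conj (circleMap 0 r θ) = (r : ℂ) ^ 2 * (circleMap 0 r θ)⁻¹ := by
      rw [Complex.inv_def, Complex.normSq_eq_norm_sq, norm_circleMap_zero, sq_abs]
      have : (r : ℂ) ≠ 0 := Complex.ofReal_ne_zero.mpr h0.ne'
      push_cast
      field_simp
    rw [hc, deriv_circleMap, sub_zero]
    simp only [smul_eq_mul, mul_pow, inv_pow]
    have := Complex.I_ne_zero
    field_simp
    ring
  simp only [hcongr]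
  rw [intervalIntegral.integral_const_mul, h, smul_eq_mul]
  have := Complex.I_ne_zero
  field_simp

/-- Integration against `z̄ ^ k` extracts the Taylor coefficient of order `k`. -/
theorem integral_conj_pow_mul {g : ℂ → ℂ} (hg : DifferentiableOn ℂ g (ball 0 1))
    (hi : Integrable g diskMeasure) (k : ℕ) :
    ∫ z, conj z ^ k * g z ∂diskMeasure = iteratedDeriv k g 0 / k.factorial / (k + 1) := by
  have hc : ContinuousOn (fun z => conj z ^ k * g z) (ball 0 1) :=
    ContinuousOn.mul (by fun_prop) hg.continuousOn
  rw [integral_diskMeasure, integral_ball_eq_polar hc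
    (integrableOn_of_integrable_diskMeasure (integrable_conj_pow_mul hi k))]
  set a := iteratedDeriv k g 0 / k.factorial
  have h1 : ∫ r in Set.Ioo (0 : ℝ) 1, r • ∫ θ in (0 : ℝ)..(2 * Real.pi),
      conj (circleMap 0 r θ) ^ k * g (circleMap 0 r θ) =
      ∫ r in Set.Ioo (0 : ℝ) 1, ((r ^ (2 * k + 1) : ℝ) : ℂ) * (2 * Real.pi * a) := by
    refine setIntegral_congr_fun measurableSet_Ioo fun r hr => ?_
    rw [integral_circle_conj_pow_mul hg k hr.1 hr.2, Complex.real_smul]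
    push_cast
    ring
  have h2 : ∫ r in Set.Ioo (0 : ℝ) 1, r ^ (2 * k + 1) = 1 / (2 * k + 2) := by
    rw [← integral_Ioc_eq_integral_Ioo, ← intervalIntegral.integral_of_le zero_le_one,
      integral_pow]
    push_cast
    norm_num
    ring
  rw [h1, integral_mul_const, integral_complex_ofReal, h2]
  have hpi : (Real.pi : ℂ) ≠ 0 := Complex.ofReal_ne_zero.mpr Real.pi_ne_zero
  have hk : (k : ℂ) + 1 ≠ 0 := Nat.cast_add_one_ne_zero k
  push_cast
  rw [show (2 * k + 2 : ℂ) = 2 * (k + 1) by ring]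
  field_simp

theorem memLp_pow (n : ℕ) (p : ℝ≥0∞) : MemLp (fun z : ℂ => z ^ n) p diskMeasure := by
  refine MemLp.of_bound (by fun_prop) 1 ?_
  filter_upwards [ae_diskMeasure_mem_ball] with z hz
  rw [norm_pow]
  exact pow_le_one₀ (norm_nonneg _) (mem_ball_zero_iff.mp hz).le

theorem integral_conj_pow_mul_pow (j n : ℕ) :
    ∫ z, conj z ^ j * z ^ n ∂diskMeasure = if j = n then 1 / ((n : ℂ) + 1) else 0 := by
  rw [integral_conj_pow_mul (by fun_prop) (memLp_one_iff_integrable.mp (memLp_pow n 1)),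
    iteratedDeriv_fun_pow_zero]
  by_cases h : j = n
  · subst h
    have : (j.factorial : ℂ) ≠ 0 := Nat.cast_ne_zero.mpr j.factorial_ne_zero
    simp [this]
  · simp [h]

theorem memLp_const_mul_pow (c : ℂ) (n : ℕ) : MemLp (fun z : ℂ => c * z ^ n) 2 diskMeasure :=
  (memLp_pow n 2).const_mul c

/-- The normalized monomial `√(n + 1) z ^ n`. -/
noncomputable def bergmanMonomial (n : ℕ) : bergmanSpace :=
  ⟨(memLp_const_mul_pow (Real.sqrt (n + 1)) n).toLp, fun z => (Real.sqrt (n + 1) : ℂ) * z ^ n,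
    by fun_prop, (memLp_const_mul_pow (Real.sqrt (n + 1)) n).coeFn_toLp⟩

theorem coeFn_bergmanMonomial (n : ℕ) :
    (bergmanMonomial n : Lp ℂ 2 diskMeasure) =ᵐ[diskMeasure]
      fun z => (Real.sqrt (n + 1) : ℂ) * z ^ n :=
  (memLp_const_mul_pow (Real.sqrt (n + 1)) n).coeFn_toLp

theorem inner_bergmanMonomial_left (j : ℕ) (f : Lp ℂ 2 diskMeasure) {g : ℂ → ℂ}
    (hfg : f =ᵐ[diskMeasure] g) :
    inner ℂ (bergmanMonomial j : Lp ℂ 2 diskMeasure) f =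
      Real.sqrt (j + 1) * ∫ z, conj z ^ j * g z ∂diskMeasure := by
  rw [L2.inner_def, ← integral_const_mul]
  refine integral_congr_ae ?_
  filter_upwards [coeFn_bergmanMonomial j, hfg] with z h1 h2
  rw [h1, h2, RCLike.inner_apply]
  simp
  ring

theorem orthonormal_bergmanMonomial : Orthonormal ℂ bergmanMonomial := by
  rw [orthonormal_iff_ite]
  intro j n
  rw [Submodule.coe_inner, inner_bergmanMonomial_left j _ (coeFn_bergmanMonomial n)]
  have : ∀ z : ℂ, conj z ^ j * ((Real.sqrt (n + 1) : ℂ) * z ^ n) =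
      Real.sqrt (n + 1) * (conj z ^ j * z ^ n) := fun z => by ring
  simp only [this]
  rw [integral_const_mul, integral_conj_pow_mul_pow]
  split_ifs with h
  · subst h
    have h1 : ((Real.sqrt (j + 1) : ℝ) : ℂ) * Real.sqrt (j + 1) = j + 1 := by
      rw [← Complex.ofReal_mul, Real.mul_self_sqrt (by positivity)]
      push_cast
      ring
    have hk : (j : ℂ) + 1 ≠ 0 := Nat.cast_add_one_ne_zero j
    rw [← mul_assoc, h1, mul_one_div_cancel hk]
  · simp

/-- Inner products with monomials are Taylor coefficients up to nonzero factors; if all vanish, so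
does the analytic representative on the disk. -/
theorem orthogonal_span_bergmanMonomial :
    (Submodule.span ℂ (Set.range bergmanMonomial))ᗮ = ⊥ := by
  rw [Submodule.eq_bot_iff]
  rintro ⟨f, g, hg, hfg⟩ hf
  have hi : Integrable g diskMeasure :=
    ((Lp.memLp f).ae_eq hfg).integrable (by norm_num)
  have h0 : ∀ k, iteratedDeriv k g 0 = 0 := by
    intro k
    have h1 := hf (bergmanMonomial k) (Submodule.subset_span ⟨k, rfl⟩)
    rw [Submodule.coe_inner] at h1
    change inner ℂ (bergmanMonomial k : Lp ℂ 2 diskMeasure) f = 0 at h1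
    rw [inner_bergmanMonomial_left k f hfg, integral_conj_pow_mul hg hi] at h1
    have h2 : ((Real.sqrt (k + 1) : ℝ) : ℂ) ≠ 0 :=
      Complex.ofReal_ne_zero.mpr (Real.sqrt_pos.mpr (by positivity)).ne'
    have hk : (k : ℂ) + 1 ≠ 0 := Nat.cast_add_one_ne_zero k
    have : (k.factorial : ℂ) ≠ 0 := Nat.cast_ne_zero.mpr k.factorial_ne_zero
    simpa [h2, hk, this] using h1
  have hz : ∀ z ∈ ball (0 : ℂ) 1, g z = 0 := by
    intro z hz
    rw [← Complex.taylorSeries_eq_on_ball' hz hg]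
    simp [h0]
  ext1
  change f = 0
  rw [Lp.eq_zero_iff_ae_eq_zero]
  filter_upwards [hfg, ae_diskMeasure_mem_ball] with z h1 h2
  rw [h1, hz z h2]
  rfl

/-- The orthonormal basis of the Bergman space consisting of normalized monomials. -/
noncomputable def bergmanBasis : HilbertBasis ℕ ℂ bergmanSpace :=
  HilbertBasis.mkOfOrthogonalEqBot orthonormal_bergmanMonomial orthogonal_span_bergmanMonomial

theorem bergmanBasis_apply (n : ℕ) : bergmanBasis n = bergmanMonomial n := by
  rw [bergmanBasis, HilbertBasis.coe_mkOfOrthogonalEqBot]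

/-! ### The matrix of the Toeplitz operator -/

theorem coeFn_holderL_harmonicSymbol (m : ℕ) (α β : ℂ) (n : ℕ) :
    (ContinuousLinearMap.mul ℂ ℂ).holderL diskMeasure ∞ 2 2 (memLp_harmonicSymbol m α β).toLp
        (bergmanMonomial n : Lp ℂ 2 diskMeasure) =ᵐ[diskMeasure]
      fun z => harmonicSymbol m α β z * ((Real.sqrt (n + 1) : ℂ) * z ^ n) := by
  have h := (ContinuousLinearMap.mul ℂ ℂ).coeFn_holder (r := 2)
    (memLp_harmonicSymbol m α β).toLp (bergmanMonomial n : Lp ℂ 2 diskMeasure)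
  filter_upwards [h, (memLp_harmonicSymbol m α β).coeFn_toLp, coeFn_bergmanMonomial n]
    with z h1 h2 h3
  refine h1.trans ?_
  rw [h2, h3]
  rfl

/-- The left vector lies in the Bergman space, so the projection drops out of the inner product and
only moments `∫ conj z ^ a * z ^ b` remain. -/
theorem inner_harmonicToeplitz (m : ℕ) (α β : ℂ) (j n : ℕ) :
    inner ℂ (bergmanMonomial j) (harmonicToeplitz m α β (bergmanMonomial n)) =
      Real.sqrt (j + 1) * Real.sqrt (n + 1) *
        ((if j + m = n then 1 / ((n : ℂ) + 1) else 0) +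
          α * (if j = n + m then 1 / ((j : ℂ) + 1) else 0) +
          β * (if j = n then 1 / ((n : ℂ) + 1) else 0)) := by
  have h1 : inner ℂ (bergmanMonomial j) (harmonicToeplitz m α β (bergmanMonomial n)) =
      inner ℂ (bergmanMonomial j : Lp ℂ 2 diskMeasure)
        ((ContinuousLinearMap.mul ℂ ℂ).holderL diskMeasure ∞ 2 2
          (memLp_harmonicSymbol m α β).toLp (bergmanMonomial n : Lp ℂ 2 diskMeasure)) :=
    Submodule.inner_orthogonalProjectionOnto_eq_of_mem_left _ _
  rw [h1, inner_bergmanMonomial_left j _ (coeFn_holderL_harmonicSymbol m α β n)]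
  have hint : ∀ a b : ℕ, Integrable (fun z : ℂ => conj z ^ a * z ^ b) diskMeasure := fun a b =>
    integrable_conj_pow_mul (memLp_one_iff_integrable.mp (memLp_pow b 1)) a
  have h2 : ∀ z : ℂ, conj z ^ j * (harmonicSymbol m α β z * ((Real.sqrt (n + 1) : ℂ) * z ^ n)) =
      Real.sqrt (n + 1) * ((conj z ^ (j + m) * z ^ n + α * (conj z ^ j * z ^ (n + m))) +
        β * (conj z ^ j * z ^ n)) := fun z => by
    rw [harmonicSymbol]
    ring
  simp only [h2]
  rw [integral_const_mul, integral_add ((hint _ _).fun_add ((hint _ _).const_mul _))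
    ((hint _ _).const_mul _), integral_add (hint _ _) ((hint _ _).const_mul _),
    integral_const_mul, integral_const_mul, integral_conj_pow_mul_pow, integral_conj_pow_mul_pow,
    integral_conj_pow_mul_pow, mul_assoc]
  congr 5
  split_ifs with h
  · rw [h]
  · rfl

theorem bergmanMatrix_single (m : ℕ) (α c : ℂ) (j n : ℕ) :
    bergmanMatrix m α c (lp.single 2 n 1) j =
      (if j + m = n then (bergmanWeight m j : ℂ) else 0) +
        α * (if j = n + m then (bergmanWeight m n : ℂ) else 0) + c * (if j = n then 1 else 0) := by
  have h1 : (bergmanShift m).adjoint (lp.single 2 n 1) j =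
      if j + m = n then (bergmanWeight m j : ℂ) else 0 := by
    rw [adjoint_bergmanShift, mul_apply_eq_comp, weightOperator, diagonalOperator_apply,
      adjoint_forwardShift_apply, lp.single_apply, Pi.single_apply]
    simp
  have h2 : bergmanShift m (lp.single 2 n 1) j =
      if j = n + m then (bergmanWeight m n : ℂ) else 0 := by
    rw [bergmanShift, mul_apply_eq_comp, forwardShift_apply, weightOperator, diagonalOperator_apply,
      lp.single_apply, Pi.single_apply]
    by_cases h : j = n + m
    · subst h; simp
    · rw [if_neg h]
      split_ifs <;> first | omega | simp
  have h3 : (lp.single 2 n (1 : ℂ) : SqSummable) j = if j = n then 1 else 0 := by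
    rw [lp.single_apply, Pi.single_apply]
  rw [← h1, ← h2, ← h3]
  rfl

theorem sqrt_mul_sqrt_div {j n : ℕ} {m : ℕ} (h : n = j + m) :
    (Real.sqrt (j + 1) : ℂ) * Real.sqrt (n + 1) * (1 / ((n : ℂ) + 1)) = bergmanWeight m j := by
  subst h
  have h1 : (0 : ℝ) < (j + m : ℕ) + 1 := by positivity
  have h2 : Real.sqrt (j + 1) * Real.sqrt ((j + m : ℕ) + 1) * (1 / (((j + m : ℕ) : ℝ) + 1)) =
      bergmanWeight m j := by
    rw [bergmanWeight, Real.sqrt_div (by positivity)]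
    push_cast at h1 ⊢
    have h3 : Real.sqrt (j + m + 1) * Real.sqrt (j + m + 1) = j + m + 1 :=
      Real.mul_self_sqrt h1.le
    have h4 : Real.sqrt ((j : ℝ) + m + 1) ≠ 0 := (Real.sqrt_pos.mpr h1).ne'
    rw [eq_div_iff h4, mul_one_div, div_mul_eq_mul_div, mul_assoc, h3, mul_div_cancel_right₀ _ h1.ne']
  rw [← h2]
  push_cast
  ring

/-- Transport of operators from `ℓ²(ℕ)` to the Bergman space along the monomial basis. -/
noncomputable def bergmanTransport :
    (SqSummable →L[ℂ] SqSummable) ≃⋆ₐ[ℂ] (bergmanSpace →L[ℂ] bergmanSpace) :=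
  bergmanBasis.repr.symm.conjStarAlgEquiv

theorem bergmanTransport_apply (A : SqSummable →L[ℂ] SqSummable) (f : bergmanSpace) :
    bergmanTransport A f = bergmanBasis.repr.symm (A (bergmanBasis.repr f)) := rfl

theorem harmonicToeplitz_eq (m : ℕ) (α β : ℂ) :
    harmonicToeplitz m α β = bergmanTransport (bergmanMatrix m α β) := by
  refine ContinuousLinearMap.ext_on
    ((Submodule.dense_iff_topologicalClosure_eq_top).mpr bergmanBasis.dense_span) ?_
  rintro _ ⟨n, rfl⟩
  apply bergmanBasis.repr.injective
  rw [bergmanTransport_apply, LinearIsometryEquiv.apply_symm_apply, HilbertBasis.repr_self]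
  ext j
  rw [bergmanBasis.repr_apply_apply, bergmanBasis_apply, bergmanBasis_apply,
    inner_harmonicToeplitz, bergmanMatrix_single, mul_add, mul_add, mul_left_comm _ α,
    mul_left_comm _ β]
  congr 1
  · congr 1
    · split_ifs with h
      · exact sqrt_mul_sqrt_div h.symm
      · rw [mul_zero]
    · congr 1
      split_ifs with h
      · rw [mul_comm (Real.sqrt (j + 1) : ℂ)]
        exact sqrt_mul_sqrt_div h
      · rw [mul_zero]
  · congr 1
    split_ifs with h
    · rw [sqrt_mul_sqrt_div (m := 0) (by omega : n = j + 0)]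
      have : (j : ℝ) + 1 ≠ 0 := by positivity
      simp [bergmanWeight, this]
    · rw [mul_zero]

theorem harmonicToeplitz_sub (m : ℕ) (α β w : ℂ) :
    harmonicToeplitz m α β - w • ContinuousLinearMap.id ℂ bergmanSpace =
      bergmanTransport (bergmanMatrix m α (β - w)) := by
  have h : bergmanMatrix m α (β - w) = bergmanMatrix m α β - w • 1 := by
    rw [bergmanMatrix, bergmanMatrix, sub_smul]
    abel
  have h1 : bergmanTransport (w • 1) = w • 1 := by
    rw [← map_one bergmanTransport]
    exact bergmanTransport.map_smul' w 1
  rw [h, map_sub, h1, harmonicToeplitz_eq]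
  rfl

/-- Transport preserves kernels. -/
noncomputable def kerBergmanTransportEquiv (A : SqSummable →L[ℂ] SqSummable) :
    (bergmanTransport A).ker ≃ₗ[ℂ] A.ker :=
  (LinearEquiv.ofEq _ _ (by
    ext f
    change bergmanBasis.repr.symm (A (bergmanBasis.repr f)) = 0 ↔ A (bergmanBasis.repr f) = 0
    simp)).trans (bergmanBasis.repr.toLinearEquiv.ofSubmodule' A.ker)

/-! ### Index and spectrum of the Toeplitz operator -/

theorem index_of_norm_lt_one {m : ℕ} (hm : 1 ≤ m) {α β u : ℂ} (hα : ‖α‖ < 1) (hu : ‖u‖ < 1) :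
    (harmonicToeplitz m α β -
        (conj u + α * u + β) • ContinuousLinearMap.id ℂ bergmanSpace).IsFredholm ∧
      fredholmIndex (harmonicToeplitz m α β -
        (conj u + α * u + β) • ContinuousLinearMap.id ℂ bergmanSpace) = m := by
  obtain ⟨μ, ν, hμ, hν, rfl, hs⟩ := exists_roots_of_norm_lt_one hα hu
  obtain ⟨⟨G, hG⟩, ⟨e⟩⟩ := exists_rightInverse_bergmanMatrix hm hμ hν
  rw [harmonicToeplitz_sub, ← hs, sub_add_cancel_right]
  have h : bergmanTransport (bergmanMatrix m (μ * ν) (-(μ + ν))) * bergmanTransport G = 1 := by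
    rw [← map_mul, hG, map_one]
  have e' := (kerBergmanTransportEquiv _).trans e
  have : FiniteDimensional ℂ (bergmanTransport (bergmanMatrix m (μ * ν) (-(μ + ν)))).ker :=
    Module.Finite.equiv e'.symm
  refine ⟨isFredholm_of_mul_eq_one h, ?_⟩
  rw [fredholmIndex_of_mul_eq_one h, e'.finrank_eq]
  simp

/-- `T_φ - w` is the adjoint of a nonzero multiple of the right invertible operator belonging to `1
/ conj α` and the same `u`. It is therefore injective with cokernel of dimension `m`. -/
theorem index_of_one_lt_norm {m : ℕ} (hm : 1 ≤ m) {α β u : ℂ} (hα : 1 < ‖α‖) (hu : ‖u‖ < 1) :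
    (harmonicToeplitz m α β -
        (conj u + α * u + β) • ContinuousLinearMap.id ℂ bergmanSpace).IsFredholm ∧
      fredholmIndex (harmonicToeplitz m α β -
        (conj u + α * u + β) • ContinuousLinearMap.id ℂ bergmanSpace) = -m := by
  have hα0 : α ≠ 0 := norm_pos_iff.mp (by linarith)
  have hα1 : conj α ≠ 0 := by simpa using hα0
  have hα' : ‖(conj α)⁻¹‖ < 1 := by
    rw [norm_inv, RCLike.norm_conj]
    exact inv_lt_one_of_one_lt₀ hα
  obtain ⟨μ, ν, hμ, hν, hp, hs⟩ := exists_roots_of_norm_lt_one hα' hu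
  obtain ⟨⟨G, hG⟩, ⟨e⟩⟩ := exists_rightInverse_bergmanMatrix hm hμ hν
  have hc : conj (-(conj u + α * u)) / conj α = -(μ + ν) := by
    rw [hs]
    simp only [map_neg, map_add, map_mul, Complex.conj_conj]
    field_simp
    ring
  have hstar : ∀ A, bergmanTransport (star A) = (bergmanTransport A).adjoint :=
    bergmanTransport.map_star'
  rw [harmonicToeplitz_sub, sub_add_cancel_right, bergmanMatrix_eq_adjoint m hα0, hc, ← hp, hstar]
  set B := conj α • bergmanMatrix m (μ * ν) (-(μ + ν)) with hB
  have h : bergmanTransport B * bergmanTransport ((conj α)⁻¹ • G) = 1 := by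
    rw [← map_mul, hB, smul_mul_smul_comm, mul_inv_cancel₀ hα1, one_smul, hG, map_one]
  have hk : B.ker = (bergmanMatrix m (μ * ν) (-(μ + ν))).ker := LinearMap.ker_smul _ _ hα1
  have e' := ((kerBergmanTransportEquiv B).trans (LinearEquiv.ofEq _ _ hk)).trans e
  have : FiniteDimensional ℂ (bergmanTransport B).ker := Module.Finite.equiv e'.symm
  refine ⟨isFredholm_adjoint_of_mul_eq_one h, ?_⟩
  rw [fredholmIndex_adjoint_of_mul_eq_one h, e'.finrank_eq]
  simp

theorem fredholmIndex_eq_zero_of_isUnit {H : Type*} [NormedAddCommGroup H] [NormedSpace ℂ H]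
    {T : H →L[ℂ] H} (hT : IsUnit T) : fredholmIndex T = 0 := by
  obtain ⟨u, rfl⟩ := hT
  rw [fredholmIndex_of_mul_eq_one u.mul_inv]
  have : (u : H →L[ℂ] H).ker = ⊥ := by
    rw [LinearMap.ker_eq_bot]
    refine Function.LeftInverse.injective (g := (↑u⁻¹ : H →L[ℂ] H)) fun x => ?_
    exact congrArg (fun A : H →L[ℂ] H => A x) u.inv_mul
  rw [this, finrank_bot, Nat.cast_zero]

/-- The operator `T_φ - φ(z)` is not invertible. For `|α| = 1` this follows by approximation from
the case `|α| ≠ 1`. -/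
theorem not_isUnit_bergmanMatrix {m : ℕ} (hm : 1 ≤ m) (α : ℂ) {u : ℂ} (hu : ‖u‖ < 1) :
    ¬ IsUnit (bergmanMatrix m α (-(conj u + α * u))) := by
  have hne : ∀ a : ℂ, ‖a‖ ≠ 1 → ¬ IsUnit (bergmanMatrix m a (-(conj u + a * u))) := by
    intro a ha h
    have h1 := fredholmIndex_eq_zero_of_isUnit (h.map bergmanTransport)
    -- `β = 0` loses nothing, since the matrix depends only on `β - w`.
    have h2 := harmonicToeplitz_sub m a 0 (conj u + a * u + 0)
    rw [sub_add_cancel_right] at h2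
    rw [← h2] at h1
    rcases lt_or_gt_of_ne ha with ha | ha
    · rw [(index_of_norm_lt_one hm ha hu).2] at h1
      omega
    · rw [(index_of_one_lt_norm hm ha hu).2] at h1
      omega
  by_cases hα : ‖α‖ = 1
  swap
  · exact hne α hα
  -- The parameters `t α` with `t > 1` have modulus different from `1`, so the operators on this
  -- path are not invertible there; closedness passes this to the endpoint `t = 1`.
  have hcont : Continuous fun t : ℝ => bergmanMatrix m (t * α) (-(conj u + t * α * u)) := by
    unfold bergmanMatrix
    fun_prop
  have hcl : IsClosed {t : ℝ | ¬ IsUnit (bergmanMatrix m (t * α) (-(conj u + t * α * u)))} :=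
    (Units.isOpen.preimage hcont).isClosed_compl
  have hsub : Set.Ioi (1 : ℝ) ⊆
      {t : ℝ | ¬ IsUnit (bergmanMatrix m (t * α) (-(conj u + t * α * u)))} := by
    intro t ht
    refine hne _ ?_
    have ht' : (1 : ℝ) < t := ht
    rw [norm_mul, hα, mul_one, Complex.norm_real, Real.norm_of_nonneg (by linarith)]
    exact ht'.ne'
  have h1 : (1 : ℝ) ∈ closure (Set.Ioi (1 : ℝ)) := by
    rw [closure_Ioi]
    exact Set.mem_Ici.mpr le_rfl
  have := hcl.closure_subset_iff.mpr hsub h1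
  simpa using this

theorem image_subset_spectrum {m : ℕ} (hm : 1 ≤ m) (α β : ℂ) :
    harmonicSymbol m α β '' ball 0 1 ⊆ spectrum ℂ (harmonicToeplitz m α β) := by
  rw [image_harmonicSymbol_ball hm]
  rintro _ ⟨u, hu, rfl⟩
  rw [spectrum.mem_iff, IsUnit.sub_iff, Algebra.algebraMap_eq_smul_one]
  change ¬ IsUnit (harmonicToeplitz m α β - _ • ContinuousLinearMap.id ℂ bergmanSpace)
  rw [harmonicToeplitz_sub, MulEquiv.isUnit_map, sub_add_cancel_right]
  exact not_isUnit_bergmanMatrix hm α (mem_ball_zero_iff.mp hu)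

theorem proposition5p1 (m : ℕ) (hm : 1 ≤ m) (α β : ℂ) :
    -- the closure of the image of the disk lies in the spectrum
    closure (harmonicSymbol m α β '' ball 0 1) ⊆ spectrum ℂ (harmonicToeplitz m α β) ∧
    (‖α‖ ≠ 1 →
      -- the image of the disk is the open region bounded by an ellipse centred at `β`
      (∃ ζ : ℂ, ‖ζ‖ = 1 ∧ α = ‖α‖ * ζ ^ 2 ∧
        harmonicSymbol m α β '' ball 0 1 =
          {w : ℂ | ∃ x y : ℝ, w = β + ζ * (x + y * Complex.I) ∧
            x ^ 2 / (‖α‖ + 1) ^ 2 + y ^ 2 / (‖α‖ - 1) ^ 2 < 1}) ∧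
      -- in this region the winding number, hence the Fredholm index, does not vanish
      ∀ w ∈ harmonicSymbol m α β '' ball 0 1,
        w ∉ harmonicSymbol m α β '' sphere 0 1 ∧
        windingNumber (harmonicSymbol m α β) w ≠ 0 ∧
        (harmonicToeplitz m α β - w • ContinuousLinearMap.id ℂ bergmanSpace).IsFredholm ∧
        (fredholmIndex (harmonicToeplitz m α β - w • ContinuousLinearMap.id ℂ bergmanSpace) : ℂ)
          = -windingNumber (harmonicSymbol m α β) w ∧
        fredholmIndex (harmonicToeplitz m α β - w • ContinuousLinearMap.id ℂ bergmanSpace) ≠ 0) := by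
  refine ⟨closure_minimal (image_subset_spectrum hm α β) (spectrum.isClosed (𝕜 := ℂ) (harmonicToeplitz m α β)), fun hα => ?_⟩
  rw [image_harmonicSymbol_ball hm]
  refine ⟨exists_image_eq_ellipse hα β, ?_⟩
  rintro _ ⟨u, hu, rfl⟩
  rw [mem_ball_zero_iff] at hu
  have hm0 : (m : ℂ) ≠ 0 := Nat.cast_ne_zero.mpr (by omega)
  refine ⟨notMem_image_sphere hα hu, ?_⟩
  rcases lt_or_gt_of_ne hα with hα | hα
  · obtain ⟨hF, hi⟩ := index_of_norm_lt_one (β := β) hm hα hu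
    simp only [windingNumber_of_norm_lt_one hm hα hu, hi]
    exact ⟨neg_ne_zero.mpr hm0, hF, by simp, by omega⟩
  · obtain ⟨hF, hi⟩ := index_of_one_lt_norm (β := β) hm hα hu
    simp only [windingNumber_of_one_lt_norm hm hα hu, hi]
    exact ⟨hm0, hF, by simp, by omega⟩
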